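/- Theorem 4.9 (semi-conical case). Let $h_1,h_2\in C^\infty(\mathbb R^3,\mathbb R)$ and $m\in C^\infty(\mathbb R,\mathbb R)$ satisfy $h_1(0)=h_2(0)\neq 0$ and $m(0)\notin\{-1,0\}$, and let $$f(u,v,z)=\begin{pmatrix} h_1(u,v,z)\,(z-m(u)u)\\ h_2(u,v,z)\,(z+u+v^2)\end{pmatrix},\qquad H_f=\begin{pmatrix} f_1&f_2\\ f_2&-f_1\end{pmatrix}.$$ Let $U$ be a compact neighborhood of $0$ in $\mathbb R^2$ and $z_0<0<z_1$ be such that $h_1h_2$ does not vanish on $U\times[z_0,z_1]$ and $m(u)\notin\{-1,0\}$ for every $(u,v)\in U$. Let $\mathcal C=\{(u,v,z)\in U\times[z_0,z_1] : f(u,v,z)=0\}$, and let $\pi(\mathcal C)$ be its projection on the $(u,v)$-plane. Let $(u,v):[0,1]\to\mathbb R^2$ be a $C^\infty$ path with nowhere vanishing derivative which satisfies (C): $(u(t),v(t))\in\pi(\mathcal C)$ for every $t\in[0,1]$; $(u(0),v(0),z_0)\in\mathcal C$ and this point is an F-conical intersection, i.e. there $f=0$, $\det\big(\partial f/\partial(u,v)\big)\neq0$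 and $\partial_z f\ne 0$; and $(u(1),v(1))=(0,0)$. Assume also that for every $z\in[z_0,0]$ there is at most one $t\in[0,1]$ such that $(u(t),v(t),z)\in\mathcal C$. Let $\phi_-^z(u,v)$ and $\phi_+^z(u,v)$ be real normalized eigenvectors (unique up to sign where $f\neq0$) of $H_f(u,v,z)$ for its smallest and its largest eigenvalue. For $\epsilon>0$ and $z\in[z_0,z_1]$ let $\psi^z_\epsilon:[0,1/\epsilon]\to\mathbb C^2$ be the solution of $$i\,\frac{d\psi^z_\epsilon(t)}{dt}=H_f(u(\epsilon t),v(\epsilon t),z)\,\psi^z_\epsilon(t),\qquad \psi^z_\epsilon(0)=\tilde\psi^z_0,$$ where $\tilde\psi_0^z=\phi_-^z(u(0),v(0))$ for $z\in(z_0,z_1]$ and $\tilde\psi_0^{z_0}=\lim_{t\to0^+}\phi_-^{z_0}(u(t),v(t))$. Set $T_\epsilon(z)=\left|\langle\psi^z_\epsilon(1/\epsilon),\phi^z_+(u(1),v(1))\rangle\right|$, where for $z=0$ the vector $\phi^0_+(u(1),v(1))$ is understood as $\lim_{t\to1^-}\phi^0_+(u(t),v(t))$ (the signs being chosen so that these two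 limits exist). Then, as $\epsilon\to0^+$, uniformly with respect to $z\in[z_0,z_1]$, $$T_\epsilon(z)\to\begin{cases}1&\text{if } z\in(z_0,0),\\ 0&\text{if } z\in[0,z_1]\cup\{z_0\}.\end{cases}$$ More precisely, $T_\epsilon(z)=O(\epsilon^{1/3})$ as $\epsilon\to 0^+$, uniformly with respect to $z\in[0,z_1]\cup\{z_0\}$. -/

import Mathlib

open Set Filter Topology
open scoped ContDiff Matrix

noncomputable section

namespace SemiConical

/-- The real two-level Hamiltonian `H_f = [[f₁, f₂], [f₂, -f₁]]` of `f = (f₁, f₂)`, as a function of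
the point `(u, v, z)`. -/
def hamiltonian (f : ℝ × ℝ × ℝ → ℝ × ℝ) (p : ℝ × ℝ × ℝ) : Matrix (Fin 2) (Fin 2) ℝ :=
  !![(f p).1, (f p).2; (f p).2, -(f p).1]

/-- The smallest eigenvalue of `H_f` (see `isLeast_lowerEigenvalue`). -/
def lowerEigenvalue (f : ℝ × ℝ × ℝ → ℝ × ℝ) (p : ℝ × ℝ × ℝ) : ℝ :=
  -√((f p).1 ^ 2 + (f p).2 ^ 2)

/-- The largest eigenvalue of `H_f` (see `isGreatest_upperEigenvalue`). -/
def upperEigenvalue (f : ℝ × ℝ × ℝ → ℝ × ℝ) (p : ℝ × ℝ × ℝ) : ℝ :=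
  √((f p).1 ^ 2 + (f p).2 ^ 2)

theorem hasEigenvalue_hamiltonian_iff (f : ℝ × ℝ × ℝ → ℝ × ℝ) (p : ℝ × ℝ × ℝ) (μ : ℝ) :
    Module.End.HasEigenvalue (Matrix.toLin' (hamiltonian f p)) μ ↔
      μ ^ 2 = (f p).1 ^ 2 + (f p).2 ^ 2 := by
  rw [Module.End.hasEigenvalue_iff_isRoot_charpoly, Matrix.charpoly_toLin',
    Matrix.charpoly_fin_two, Matrix.trace_fin_two, Matrix.det_fin_two]
  simp only [hamiltonian, Polynomial.IsRoot.def, Matrix.of_apply, Matrix.cons_val', Matrix.cons_val_zero,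
    Matrix.cons_val_one, Matrix.cons_val_fin_one]
  simp
  constructor <;> intro h <;> linarith

theorem isLeast_lowerEigenvalue (f : ℝ × ℝ × ℝ → ℝ × ℝ) (p : ℝ × ℝ × ℝ) :
    IsLeast {μ : ℝ | Module.End.HasEigenvalue (Matrix.toLin' (hamiltonian f p)) μ}
      (lowerEigenvalue f p) := by
  refine ⟨?_, fun μ hμ => ?_⟩
  · simp only [Set.mem_ofPred_eq, hasEigenvalue_hamiltonian_iff, lowerEigenvalue, neg_sq]
    exact Real.sq_sqrt (by positivity)
  · simp only [Set.mem_ofPred_eq, hasEigenvalue_hamiltonian_iff] at hμ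
    rw [lowerEigenvalue, ← hμ, Real.sqrt_sq_eq_abs]
    exact neg_abs_le μ

theorem isGreatest_upperEigenvalue (f : ℝ × ℝ × ℝ → ℝ × ℝ) (p : ℝ × ℝ × ℝ) :
    IsGreatest {μ : ℝ | Module.End.HasEigenvalue (Matrix.toLin' (hamiltonian f p)) μ}
      (upperEigenvalue f p) := by
  refine ⟨?_, fun μ hμ => ?_⟩
  · simp only [Set.mem_ofPred_eq, hasEigenvalue_hamiltonian_iff, upperEigenvalue]
    exact Real.sq_sqrt (by positivity)
  · simp only [Set.mem_ofPred_eq, hasEigenvalue_hamiltonian_iff] at hμ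
    rw [upperEigenvalue, ← hμ, Real.sqrt_sq_eq_abs]
    exact le_abs_self μ

/-- `x` is a real normalized eigenvector of `H_f(p)` for its smallest eigenvalue: a possible
choice of `φ₋` at `p` (unique up to sign if `f p ≠ 0`). -/
def IsLowerEigenvector (f : ℝ × ℝ × ℝ → ℝ × ℝ) (p : ℝ × ℝ × ℝ)
    (x : EuclideanSpace ℝ (Fin 2)) : Prop :=
  ‖x‖ = 1 ∧ hamiltonian f p *ᵥ (x : Fin 2 → ℝ) = lowerEigenvalue f p • (x : Fin 2 → ℝ)

/-- `x` is a real normalized eigenvector of `H_f(p)` for its largest eigenvalue: a possible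
choice of `φ₊` at `p` (unique up to sign if `f p ≠ 0`). -/
def IsUpperEigenvector (f : ℝ × ℝ × ℝ → ℝ × ℝ) (p : ℝ × ℝ × ℝ)
    (x : EuclideanSpace ℝ (Fin 2)) : Prop :=
  ‖x‖ = 1 ∧ hamiltonian f p *ᵥ (x : Fin 2 → ℝ) = upperEigenvalue f p • (x : Fin 2 → ℝ)

/-- `x` is the limit, as `t → 0⁺`, of normalized eigenvectors `φ₋` of `H_f(u(t), v(t), z)`. -/
def IsInitialLimitLower (f : ℝ × ℝ × ℝ → ℝ × ℝ) (u v : ℝ → ℝ) (z : ℝ)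
    (x : EuclideanSpace ℝ (Fin 2)) : Prop :=
  ∃ φ : ℝ → EuclideanSpace ℝ (Fin 2),
    (∀ t ∈ Ioo (0 : ℝ) 1, IsLowerEigenvector f (u t, v t, z) (φ t)) ∧
      Tendsto φ (𝓝[>] 0) (𝓝 x)

/-- `x` is the limit, as `t → 1⁻`, of normalized eigenvectors `φ₊` of `H_f(u(t), v(t), z)`. -/
def IsFinalLimitUpper (f : ℝ × ℝ × ℝ → ℝ × ℝ) (u v : ℝ → ℝ) (z : ℝ)
    (x : EuclideanSpace ℝ (Fin 2)) : Prop :=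
  ∃ φ : ℝ → EuclideanSpace ℝ (Fin 2),
    (∀ t ∈ Ioo (0 : ℝ) 1, IsUpperEigenvector f (u t, v t, z) (φ t)) ∧
      Tendsto φ (𝓝[<] 1) (𝓝 x)

/-- A real vector seen as a state in `ℂ²`. -/
def toState (x : EuclideanSpace ℝ (Fin 2)) : EuclideanSpace ℂ (Fin 2) :=
  WithLp.toLp 2 (fun i => ((x i : ℝ) : ℂ))

/-- `ψ` solves `i dψ/dt = H_f(u(εt), v(εt), z) ψ` on `[0, 1/ε]`, with `ψ(0) = ψ₀`. -/
def IsSchrodingerSolution (f : ℝ × ℝ × ℝ → ℝ × ℝ) (u v : ℝ → ℝ) (ε z : ℝ)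
    (ψ₀ : EuclideanSpace ℂ (Fin 2)) (ψ : ℝ → EuclideanSpace ℂ (Fin 2)) : Prop :=
  ψ 0 = ψ₀ ∧ ∀ t ∈ Icc (0 : ℝ) (1 / ε), ∃ d : EuclideanSpace ℂ (Fin 2),
    HasDerivWithinAt ψ d (Icc 0 (1 / ε)) t ∧
      Complex.I • d = WithLp.toLp 2
        ((hamiltonian f (u (ε * t), v (ε * t), z)).map (fun r : ℝ => (r : ℂ)) *ᵥ
          (ψ t : Fin 2 → ℂ))

/-- The normal form `(u, v, z) ↦ (h₁(u,v,z) (z - m(u) u), h₂(u,v,z) (z + u + v²))`. -/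
def normalForm (h₁ h₂ : ℝ × ℝ × ℝ → ℝ) (m : ℝ → ℝ) (p : ℝ × ℝ × ℝ) : ℝ × ℝ :=
  (h₁ p * (p.2.2 - m p.1 * p.1), h₂ p * (p.2.2 + p.1 + p.2.1 ^ 2))

/-- `∂₁ f` at `(u, v, z)`. -/
def partial₁ (f : ℝ × ℝ × ℝ → ℝ × ℝ) (p : ℝ × ℝ × ℝ) : ℝ × ℝ :=
  deriv (fun s => f (s, p.2.1, p.2.2)) p.1

/-- `∂₂ f` at `(u, v, z)`. -/
def partial₂ (f : ℝ × ℝ × ℝ → ℝ × ℝ) (p : ℝ × ℝ × ℝ) : ℝ × ℝ :=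
  deriv (fun s => f (p.1, s, p.2.2)) p.2.1

/-- `∂₃ f` at `(u, v, z)`. -/
def partial₃ (f : ℝ × ℝ × ℝ → ℝ × ℝ) (p : ℝ × ℝ × ℝ) : ℝ × ℝ :=
  deriv (fun s => f (p.1, p.2.1, s)) p.2.2

/-- The Jacobian determinant `χ(f)` of `(u, v) ↦ f(u, v, z)`. -/
def jacobian (f : ℝ × ℝ × ℝ → ℝ × ℝ) (p : ℝ × ℝ × ℝ) : ℝ :=
  (partial₁ f p).1 * (partial₂ f p).2 - (partial₂ f p).1 * (partial₁ f p).2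

/-- `p` is an F-conical intersection (conical for the family) of the smooth map `f`. -/
def IsFConical (f : ℝ × ℝ × ℝ → ℝ × ℝ) (p : ℝ × ℝ × ℝ) : Prop :=
  f p = 0 ∧ jacobian f p ≠ 0 ∧ partial₃ f p ≠ 0

/-- The crossing set `𝒞 = Z(f) ∩ (U × [z₀, z₁])`. -/
def crossingSet (f : ℝ × ℝ × ℝ → ℝ × ℝ) (U : Set (ℝ × ℝ)) (z₀ z₁ : ℝ) : Set (ℝ × ℝ × ℝ) :=
  {p | f p = 0 ∧ (p.1, p.2.1) ∈ U ∧ p.2.2 ∈ Icc z₀ z₁}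

/-- A regular `C^∞` control path `t ↦ (u(t), v(t))` on `[0, 1]`. -/
structure IsRegularSmoothPath (u v : ℝ → ℝ) : Prop where
  smooth_u : ContDiffOn ℝ ∞ u (Icc 0 1)
  smooth_v : ContDiffOn ℝ ∞ v (Icc 0 1)
  regular : ∀ t ∈ Icc (0 : ℝ) 1,
    (derivWithin u (Icc 0 1) t, derivWithin v (Icc 0 1) t) ≠ ((0, 0) : ℝ × ℝ)

/-- Condition (C): the path stays in the projection of the crossing set on the plane of controls,
starts under an F-conical point at level `z₀`, and ends at the origin. -/
structure ConditionC (f : ℝ × ℝ × ℝ → ℝ × ℝ) (U : Set (ℝ × ℝ)) (z₀ z₁ : ℝ) (u v : ℝ → ℝ) :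
    Prop where
  mem_proj : ∀ t ∈ Icc (0 : ℝ) 1, ∃ z, (u t, v t, z) ∈ crossingSet f U z₀ z₁
  start_mem : (u 0, v 0, z₀) ∈ crossingSet f U z₀ z₁
  start_conical : IsFConical f (u 0, v 0, z₀)
  final_u : u 1 = 0
  final_v : v 1 = 0

/-- The quantity `T = |⟨ψ(1/ε), φ₊⟩|`. -/
def transition (ψ : ℝ → EuclideanSpace ℂ (Fin 2)) (ε : ℝ) (φ : EuclideanSpace ℝ (Fin 2)) : ℝ :=
  ‖inner ℂ (ψ (1 / ε)) (toState φ)‖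

end SemiConical

end

/-! Along the path the two factors `z - m(u)u` and `z + u + v²` coincide: both equal `z - ζ(t)`,
where `ζ(t)` is the level of the crossing above the point at time `t`. Hence `H_f = (z - ζ)ρ [[cos
θ, sin θ], [sin θ, -cos θ]]` with `ρ > 0`, and the frame of half angle `θ/2` diagonalizes `H_f`
smoothly even through a crossing; only the signed gap `(z - ζ)ρ` vanishes there
(`exists_isRotatingFrame`). Uniqueness of the crossing time makes `ζ` strictly increasing from `z₀`
to `0` (`strictMonoOn_level`).

Adiabatically, a coordinate in this frame that is zero initially stays small. For `z ∈ (z₀, 0)` the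
gap changes sign once, so the frame vector that starts as the lower eigenvector ends as the upper
one and `T → 1`. For `z = z₀` or `z ≥ 0` the gap has one sign in the interior of the path, and `T →
0`.

Quantitatively, if `|z - ζ| ≥ η` outside a window of radius `δ`, the small coordinate is `O(ε/η +
δ)` with constants uniform in `z` (`norm_one_le`). The window is bounded trivially; outside it one
integrates by parts. Compactness yields some `η` for each `δ`, hence uniform convergence. For `z ∈
[0, z₁] ∪ {z₀}` one may take `η` of order `δ²`, because `ζ` leaves its end values at least
quadratically; `δ = ε^{1/3}` balances the two errors. -/

/-! ### Two-level equations in a rotating frame. -/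

/-- The equations `p' = -iκp + wq`, `q' = iκq - wp` on `s`, satisfied by the coordinates of a
two-level state in a rotating real eigenframe. -/
structure IsAdiabaticPair (κ w : ℝ → ℝ) (p q : ℝ → ℂ) (s : Set ℝ) : Prop where
  deriv_fst : ∀ t ∈ s, HasDerivWithinAt p (-Complex.I * κ t * p t + w t * q t) s t
  deriv_snd : ∀ t ∈ s, HasDerivWithinAt q (Complex.I * κ t * q t - w t * p t) s t

namespace IsAdiabaticPair

variable {κ w : ℝ → ℝ} {p q : ℝ → ℂ} {s : Set ℝ}

theorem swap (h : IsAdiabaticPair κ w p q s) :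
    IsAdiabaticPair (fun t => -κ t) (fun t => -w t) q p s where
  deriv_fst t ht := by
    convert h.deriv_snd t ht using 1
    push_cast; ring
  deriv_snd t ht := by
    convert h.deriv_fst t ht using 1
    push_cast; ring

theorem mono {s' : Set ℝ} (h : IsAdiabaticPair κ w p q s) (hs : s' ⊆ s) :
    IsAdiabaticPair κ w p q s' where
  deriv_fst t ht := (h.deriv_fst t (hs ht)).mono hs
  deriv_snd t ht := (h.deriv_snd t (hs ht)).mono hs

theorem norm_sq_add_norm_sq {a b : ℝ} (h : IsAdiabaticPair κ w p q (Icc a b)) {t : ℝ}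
    (ht : t ∈ Icc a b) : ‖p t‖ ^ 2 + ‖q t‖ ^ 2 = ‖p a‖ ^ 2 + ‖q a‖ ^ 2 := by
  have key : ∀ x ∈ Icc a b,
      HasDerivWithinAt (fun t => ‖p t‖ ^ 2 + ‖q t‖ ^ 2) 0 (Icc a b) x := by
    intro x hx
    refine ((h.deriv_fst x hx).norm_sq.add (h.deriv_snd x hx).norm_sq).congr_deriv ?_
    simp only [Complex.inner, Complex.mul_re, Complex.add_re, Complex.sub_re, Complex.add_im,
      Complex.sub_im, Complex.mul_im, Complex.neg_re, Complex.neg_im, Complex.conj_re,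
      Complex.conj_im, Complex.I_re, Complex.I_im, Complex.ofReal_re, Complex.ofReal_im]
    ring
  refine constant_of_has_deriv_right_zero (fun x hx => (key x hx).continuousWithinAt)
    (fun x hx => (key x (Ico_subset_Icc_self hx)).mono_of_mem_nhdsWithin
      (Icc_mem_nhdsGE_of_mem hx)) t ht

end IsAdiabaticPair

/-- Multiplication by `exp(i∫κ)` removes the term `-iκF` without changing the modulus, so the bound
does not depend on the size of `κ`, which will be of order `1/ε`. -/
theorem norm_le_add_of_hasDerivWithinAt_phase {a b : ℝ} (hab : a ≤ b) {κ B B' : ℝ → ℝ}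
    {F R : ℝ → ℂ} (hκ : ContinuousOn κ (Icc a b))
    (hF : ∀ t ∈ Icc a b, HasDerivWithinAt F (-Complex.I * κ t * F t + R t) (Icc a b) t)
    (hB : ∀ t ∈ Icc a b, HasDerivWithinAt B (B' t) (Icc a b) t)
    (hR : ∀ t ∈ Icc a b, ‖R t‖ ≤ B' t) : ‖F b‖ ≤ ‖F a‖ + (B b - B a) := by
  -- Extending `κ` by constants makes its primitive differentiable on the whole line, end points
  -- included.
  set κ' : ℝ → ℝ := IccExtend hab ((Icc a b).domRestrict κ) with hκ'
  have cκ' : Continuous κ' := (continuousOn_iff_continuous_domRestrict.1 hκ).Icc_extend'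
  have eκ' : ∀ t ∈ Icc a b, κ' t = κ t := fun t ht => by
    rw [hκ', IccExtend_of_mem hab _ ht]; rfl
  set Φ : ℝ → ℝ := fun t => ∫ x in a..t, κ' x
  have hΦ : ∀ t, HasDerivAt Φ (κ' t) t := fun t =>
    intervalIntegral.integral_hasDerivAt_right (cκ'.intervalIntegrable _ _)
      (cκ'.stronglyMeasurableAtFilter _ _) cκ'.continuousAt
  set G : ℝ → ℂ := fun t => Complex.exp (Φ t * Complex.I) * F t
  have nG : ∀ t, ‖G t‖ = ‖F t‖ := fun t => by
    simp only [G, norm_mul, Complex.norm_exp_ofReal_mul_I, one_mul]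
  have hG : ∀ t ∈ Icc a b,
      HasDerivWithinAt G (Complex.exp (Φ t * Complex.I) * R t) (Icc a b) t := by
    intro t ht
    refine ((((hΦ t).ofReal_comp.mul_const Complex.I).cexp.hasDerivWithinAt
      (s := Icc a b)).mul (hF t ht)).congr_deriv ?_
    rw [eκ' t ht]
    ring
  have := image_norm_le_of_norm_deriv_right_le_deriv_boundary' (a := a) (b := b) (f := G)
    (f' := fun t => Complex.exp (Φ t * Complex.I) * R t) (B := fun t => ‖F a‖ + (B t - B a))
    (B' := B')
    (fun t ht => (hG t ht).continuousWithinAt)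
    (fun x hx => (hG x (Ico_subset_Icc_self hx)).mono_of_mem_nhdsWithin (Icc_mem_nhdsGE_of_mem hx))
    (by simp [nG])
    (fun t ht => (((hB t ht).sub_const _).const_add _).continuousWithinAt)
    (fun x hx => (((hB x (Ico_subset_Icc_self hx)).sub_const _).const_add _).mono_of_mem_nhdsWithin
      (Icc_mem_nhdsGE_of_mem hx))
    (fun x hx => by
      simpa only [norm_mul, Complex.norm_exp_ofReal_mul_I, one_mul] using
        hR x (Ico_subset_Icc_self hx))
    (right_mem_Icc.2 hab)
  simpa only [nG] using this

namespace IsAdiabaticPair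

variable {κ w : ℝ → ℝ} {p q : ℝ → ℂ} {a b : ℝ}

/-- The trivial bound: the first coordinate grows at most at rate `|w|`. -/
theorem norm_le_add_mul (h : IsAdiabaticPair κ w p q (Icc a b)) (hab : a ≤ b)
    (hκ : ContinuousOn κ (Icc a b)) (hq : ∀ t ∈ Icc a b, ‖q t‖ ≤ 1) {W : ℝ}
    (hw : ∀ t ∈ Icc a b, |w t| ≤ W) : ‖p b‖ ≤ ‖p a‖ + W * (b - a) := by
  have := norm_le_add_of_hasDerivWithinAt_phase hab (B := fun t => W * t) (B' := fun _ => W) hκ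
    h.deriv_fst (fun t _ => by simpa using ((hasDerivAt_id t).const_mul W).hasDerivWithinAt)
    (fun t ht => by
      have h0 : 0 ≤ W := (abs_nonneg _).trans (hw t ht)
      rw [norm_mul, Complex.norm_real, Real.norm_eq_abs]
      nlinarith [hw t ht, hq t ht, norm_nonneg (q t), abs_nonneg (w t)])
  linarith

/-- The bound obtained by one integration by parts where the gap `g` does not vanish. -/
theorem norm_le_of_gap_ne_zero {g g' w' B B' : ℝ → ℝ} {ε : ℝ} (hε : 0 < ε)
    (h : IsAdiabaticPair (fun t => g t / ε) w p q (Icc a b)) (hab : a ≤ b)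
    (hp1 : ∀ t ∈ Icc a b, ‖p t‖ ≤ 1) (hq1 : ∀ t ∈ Icc a b, ‖q t‖ ≤ 1)
    (hg0 : ∀ t ∈ Icc a b, g t ≠ 0)
    (hg : ∀ t ∈ Icc a b, HasDerivWithinAt g (g' t) (Icc a b) t)
    (hw : ∀ t ∈ Icc a b, HasDerivWithinAt w (w' t) (Icc a b) t)
    (hB : ∀ t ∈ Icc a b, HasDerivWithinAt B (B' t) (Icc a b) t)
    (hBB : ∀ t ∈ Icc a b,
      ε / 2 * (|w' t| / |g t| + |w t| * |g' t| / g t ^ 2 + w t ^ 2 / |g t|) ≤ B' t) :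
    ‖p b‖ ≤ ‖p a‖ + ε / 2 * (|w a| / |g a| + |w b| / |g b|) + (B b - B a) := by
  -- With `κ = g/ε` this is `k = w/(2κ)`. In the equation of `F = p + ikq` the term `wq` is then
  -- cancelled by `-2kκq`, and only the remainder `R`, of order `ε`, is left.
  set k : ℝ → ℝ := fun t => ε / 2 * (w t / g t)
  set k' : ℝ → ℝ := fun t => ε / 2 * ((w' t * g t - w t * g' t) / g t ^ 2)
  have hk : ∀ t ∈ Icc a b, HasDerivWithinAt k (k' t) (Icc a b) t := fun t ht =>
    ((hw t ht).div (hg t ht) (hg0 t ht)).const_mul (ε / 2)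
  set F : ℝ → ℂ := fun t => p t + Complex.I * k t * q t
  set R : ℝ → ℂ := fun t => Complex.I * (k' t * q t) - Complex.I * (k t * w t * p t)
  have cg : ContinuousOn g (Icc a b) := fun t ht => (hg t ht).continuousWithinAt
  have hF : ∀ t ∈ Icc a b, HasDerivWithinAt F
      (-Complex.I * ((g t / ε : ℝ) : ℂ) * F t + R t) (Icc a b) t := by
    intro t ht
    refine ((h.deriv_fst t ht).add
      (((hk t ht).ofReal_comp.const_mul Complex.I).mul (h.deriv_snd t ht))).congr_deriv ?_
    have e1 : (k t : ℂ) * ((g t / ε : ℝ) : ℂ) = w t / 2 := by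
      have : k t * (g t / ε) = w t / 2 := by
        simp only [k]; field_simp [hg0 t ht, hε.ne']
      exact_mod_cast congrArg (fun x : ℝ => (x : ℂ)) this
    simp only [F, R]
    linear_combination (2 * Complex.I ^ 2 * q t) * e1 + (w t * q t) * Complex.I_sq
  have hR : ∀ t ∈ Icc a b, ‖R t‖ ≤ B' t := by
    intro t ht
    refine le_trans ?_ (hBB t ht)
    have hgp : 0 < |g t| := abs_pos.2 (hg0 t ht)
    have a1 : ‖R t‖ ≤ |k' t| + |k t| * |w t| := by
      refine (norm_sub_le _ _).trans ?_
      simp only [norm_mul, Complex.norm_I, one_mul, Complex.norm_real, Real.norm_eq_abs]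
      exact add_le_add (mul_le_of_le_one_right (abs_nonneg _) (hq1 t ht))
        (mul_le_of_le_one_right (by positivity) (hp1 t ht))
    have a2 : |k' t| ≤ ε / 2 * (|w' t| / |g t| + |w t| * |g' t| / g t ^ 2) := by
      simp only [k', abs_mul, abs_div, abs_of_pos (half_pos hε), abs_pow, sq_abs]
      gcongr
      have : |w' t| / |g t| = |w' t * g t| / g t ^ 2 := by
        rw [abs_mul, ← sq_abs (g t)]; field_simp
      rw [this, ← add_div, ← abs_mul]
      gcongr
      exact abs_sub _ _
    have a3 : |k t| * |w t| = ε / 2 * (w t ^ 2 / |g t|) := by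
      simp only [k, abs_mul, abs_div, abs_two, abs_of_pos hε]
      rw [← sq_abs (w t)]; ring
    rw [a3] at a1
    linarith [a1, a2, mul_add (ε / 2) (|w' t| / |g t| + |w t| * |g' t| / g t ^ 2)
      (w t ^ 2 / |g t|)]
  have main := norm_le_add_of_hasDerivWithinAt_phase hab (cg.div_const ε) hF hB hR
  have bd : ∀ t ∈ Icc a b, ‖Complex.I * k t * q t‖ ≤ ε / 2 * (|w t| / |g t|) := by
    intro t ht
    simp only [norm_mul, Complex.norm_I, one_mul, Complex.norm_real, Real.norm_eq_abs, k, abs_div,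
      abs_of_pos hε, abs_two]
    exact mul_le_of_le_one_right (by positivity) (hq1 t ht)
  have b1 : ‖F a‖ ≤ ‖p a‖ + ‖Complex.I * k a * q a‖ := norm_add_le _ _
  have b2 : ‖p b‖ ≤ ‖F b‖ + ‖Complex.I * k b * q b‖ := by
    have : p b = F b - Complex.I * k b * q b := by simp [F]
    rw [this]
    simpa using norm_sub_le (F b) (Complex.I * k b * q b)
  linarith [bd a (left_mem_Icc.2 hab), bd b (right_mem_Icc.2 hab),
    mul_add (ε / 2) (|w a| / |g a|) (|w b| / |g b|)]

end IsAdiabaticPair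

/-! ### Adiabatic estimate with a small gap. -/

/-- Uniform bounds on the data of a two-level system with gap `(z - ζ) ρ` and rotation speed `w`
on `s`, where `ζ` is nondecreasing. -/
structure IsGapBounded (M : ℝ) (ζ ζ' ρ ρ' w w' : ℝ → ℝ) (s : Set ℝ) : Prop where
  one_le : 1 ≤ M
  hasDeriv_ζ : ∀ t ∈ s, HasDerivWithinAt ζ (ζ' t) s t
  hasDeriv_ρ : ∀ t ∈ s, HasDerivWithinAt ρ (ρ' t) s t
  hasDeriv_w : ∀ t ∈ s, HasDerivWithinAt w (w' t) s t
  nonneg_ζ' : ∀ t ∈ s, 0 ≤ ζ' t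
  one_le_ρ : ∀ t ∈ s, 1 ≤ M * |ρ t|
  ρ_le : ∀ t ∈ s, |ρ t| ≤ M
  ρ'_le : ∀ t ∈ s, |ρ' t| ≤ M
  w_le : ∀ t ∈ s, |w t| ≤ M
  w'_le : ∀ t ∈ s, |w' t| ≤ M

namespace IsGapBounded

variable {M : ℝ} {ζ ζ' ρ ρ' w w' : ℝ → ℝ} {s : Set ℝ}

/-- Together with `IsAdiabaticPair.swap`, this transfers every estimate from the first coordinate to
the second. -/
theorem neg (h : IsGapBounded M ζ ζ' ρ ρ' w w' s) :
    IsGapBounded M ζ ζ' (fun t => -ρ t) (fun t => -ρ' t) (fun t => -w t) (fun t => -w' t) s where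
  one_le := h.one_le
  hasDeriv_ζ := h.hasDeriv_ζ
  hasDeriv_ρ t ht := (h.hasDeriv_ρ t ht).neg
  hasDeriv_w t ht := (h.hasDeriv_w t ht).neg
  nonneg_ζ' := h.nonneg_ζ'
  one_le_ρ t ht := by rw [abs_neg]; exact h.one_le_ρ t ht
  ρ_le t ht := by rw [abs_neg]; exact h.ρ_le t ht
  ρ'_le t ht := by rw [abs_neg]; exact h.ρ'_le t ht
  w_le t ht := by rw [abs_neg]; exact h.w_le t ht
  w'_le t ht := by rw [abs_neg]; exact h.w'_le t ht

theorem mono {s' : Set ℝ} (h : IsGapBounded M ζ ζ' ρ ρ' w w' s) (hs : s' ⊆ s) :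
    IsGapBounded M ζ ζ' ρ ρ' w w' s' where
  one_le := h.one_le
  hasDeriv_ζ t ht := (h.hasDeriv_ζ t (hs ht)).mono hs
  hasDeriv_ρ t ht := (h.hasDeriv_ρ t (hs ht)).mono hs
  hasDeriv_w t ht := (h.hasDeriv_w t (hs ht)).mono hs
  nonneg_ζ' t ht := h.nonneg_ζ' t (hs ht)
  one_le_ρ t ht := h.one_le_ρ t (hs ht)
  ρ_le t ht := h.ρ_le t (hs ht)
  ρ'_le t ht := h.ρ'_le t (hs ht)
  w_le t ht := h.w_le t (hs ht)
  w'_le t ht := h.w'_le t (hs ht)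

theorem gap_ne_zero (h : IsGapBounded M ζ ζ' ρ ρ' w w' s) {t : ℝ} (ht : t ∈ s) : ρ t ≠ 0 := by
  intro h0
  have := h.one_le_ρ t ht
  rw [h0] at this
  norm_num at this

/-- The dangerous term after integration by parts is `ζ'/(z - ζ)²`. Since `ζ' ≥ 0` it is the exact
derivative of `1/(z - ζ)`, so its integral is `O(1/η)`, whereas a pointwise bound would cost `1/η²`.
-/
theorem norm_le_of_gap_ge {p q : ℝ → ℂ} {a b z η ε : ℝ}
    (hd : IsGapBounded M ζ ζ' ρ ρ' w w' (Icc a b)) (hε : 0 < ε)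
    (h : IsAdiabaticPair (fun t => (z - ζ t) * ρ t / ε) w p q (Icc a b))
    (hab : a ≤ b) (hab1 : b - a ≤ 1)
    (hp1 : ∀ t ∈ Icc a b, ‖p t‖ ≤ 1) (hq1 : ∀ t ∈ Icc a b, ‖q t‖ ≤ 1)
    (hη : 0 < η) (hgap : ∀ t ∈ Icc a b, η ≤ |z - ζ t|) :
    ‖p b‖ ≤ ‖p a‖ + 4 * M ^ 4 * (ε / η) := by
  have hM := hd.one_le
  have hM0 : 0 < M := by linarith
  have d0 : ∀ t ∈ Icc a b, z - ζ t ≠ 0 := fun t ht h0 => by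
    have := hgap t ht
    rw [h0, abs_zero] at this
    linarith
  have M24 : M ^ 2 ≤ M ^ 4 := pow_le_pow_right₀ hM (by norm_num)
  have M34 : M ^ 3 ≤ M ^ 4 := pow_le_pow_right₀ hM (by norm_num)
  have invg : ∀ t ∈ Icc a b, 1 / |(z - ζ t) * ρ t| ≤ M / |z - ζ t| := by
    intro t ht
    have h1 := abs_pos.2 (d0 t ht)
    have h2 := abs_pos.2 (hd.gap_ne_zero ht)
    rw [abs_mul, div_le_div_iff₀ (by positivity) h1]
    nlinarith [hd.one_le_ρ t ht]
  have inv_le : ∀ t ∈ Icc a b, 1 / |z - ζ t| ≤ 1 / η := fun t ht =>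
    one_div_le_one_div_of_le hη (hgap t ht)
  have key := h.norm_le_of_gap_ne_zero (g := fun t => (z - ζ t) * ρ t)
    (g' := fun t => -ζ' t * ρ t + (z - ζ t) * ρ' t) (w' := w')
    -- The slope `3/η` pays for three terms `1/|z - ζ|`: one from `w'`, one from `ρ'`, one from
    -- `w²`.
    (B := fun t => ε / 2 * M ^ 4 * ((z - ζ t)⁻¹ + 3 / η * t))
    (B' := fun t => ε / 2 * M ^ 4 * (-(-ζ' t) / (z - ζ t) ^ 2 + 3 / η)) hε hab hp1 hq1
    (fun t ht => mul_ne_zero (d0 t ht) (hd.gap_ne_zero ht))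
    (fun t ht => ((hd.hasDeriv_ζ t ht).const_sub z).mul (hd.hasDeriv_ρ t ht))
    hd.hasDeriv_w
    (fun t ht => by
      refine (((((hd.hasDeriv_ζ t ht).const_sub z).inv (d0 t ht)).add
        ((hasDerivWithinAt_id t _).const_mul (3 / η))).const_mul (ε / 2 * M ^ 4)).congr_deriv ?_
      simp)
    (fun t ht => by
      have hdp := abs_pos.2 (d0 t ht)
      have e1 : |w' t| / |(z - ζ t) * ρ t| ≤ M ^ 4 * (1 / |z - ζ t|) := by
        calc |w' t| / |(z - ζ t) * ρ t| = |w' t| * (1 / |(z - ζ t) * ρ t|) := by ring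
          _ ≤ M * (M / |z - ζ t|) := mul_le_mul (hd.w'_le t ht) (invg t ht) (by positivity) hM0.le
          _ = M ^ 2 * (1 / |z - ζ t|) := by ring
          _ ≤ _ := by gcongr
      have e3 : w t ^ 2 / |(z - ζ t) * ρ t| ≤ M ^ 4 * (1 / |z - ζ t|) := by
        calc w t ^ 2 / |(z - ζ t) * ρ t| = |w t| ^ 2 * (1 / |(z - ζ t) * ρ t|) := by
              rw [sq_abs]; ring
          _ ≤ M ^ 2 * (M / |z - ζ t|) :=
              mul_le_mul (pow_le_pow_left₀ (abs_nonneg _) (hd.w_le t ht) 2) (invg t ht)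
                (by positivity) (by positivity)
          _ = M ^ 3 * (1 / |z - ζ t|) := by ring
          _ ≤ _ := by gcongr
      have e2 : |w t| * |-ζ' t * ρ t + (z - ζ t) * ρ' t| / ((z - ζ t) * ρ t) ^ 2 ≤
          M ^ 4 * (ζ' t / (z - ζ t) ^ 2 + 1 / |z - ζ t|) := by
        have hg' : |-ζ' t * ρ t + (z - ζ t) * ρ' t| ≤ (ζ' t + |z - ζ t|) * M := by
          refine (abs_add_le _ _).trans ?_
          rw [abs_mul, abs_mul, abs_neg, abs_of_nonneg (hd.nonneg_ζ' t ht), add_mul]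
          exact add_le_add (mul_le_mul_of_nonneg_left (hd.ρ_le t ht) (hd.nonneg_ζ' t ht))
            (mul_le_mul_of_nonneg_left (hd.ρ'_le t ht) hdp.le)
        have hζ := hd.nonneg_ζ' t ht
        calc |w t| * |-ζ' t * ρ t + (z - ζ t) * ρ' t| / ((z - ζ t) * ρ t) ^ 2
            = |w t| * |-ζ' t * ρ t + (z - ζ t) * ρ' t| * (1 / |(z - ζ t) * ρ t|) ^ 2 := by
              rw [div_pow, sq_abs]; ring
          _ ≤ M * ((ζ' t + |z - ζ t|) * M) * (M / |z - ζ t|) ^ 2 :=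
              mul_le_mul (mul_le_mul (hd.w_le t ht) hg' (abs_nonneg _) hM0.le)
                (pow_le_pow_left₀ (by positivity) (invg t ht) 2) (by positivity) (by positivity)
          _ = M ^ 4 * (ζ' t / |z - ζ t| ^ 2 + 1 / |z - ζ t|) := by
              field_simp
          _ = _ := by rw [sq_abs]
      have e4 := inv_le t ht
      rw [neg_neg, mul_assoc]
      refine mul_le_mul_of_nonneg_left ?_ (by positivity)
      have e5 : M ^ 4 * (1 / |z - ζ t|) ≤ M ^ 4 * (1 / η) := by gcongr
      have e6 : M ^ 4 * (ζ' t / (z - ζ t) ^ 2 + 3 / η) =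
        M ^ 4 * (ζ' t / (z - ζ t) ^ 2) + 3 * (M ^ 4 * (1 / η)) := by ring
      rw [mul_add] at e2
      linarith)
  have bdry : ∀ t ∈ Icc a b, |w t| / |(z - ζ t) * ρ t| ≤ M ^ 4 * (1 / η) := by
    intro t ht
    calc |w t| / |(z - ζ t) * ρ t| = |w t| * (1 / |(z - ζ t) * ρ t|) := by ring
      _ ≤ M * (M / |z - ζ t|) := mul_le_mul (hd.w_le t ht) (invg t ht) (by positivity) hM0.le
      _ = M ^ 2 * (1 / |z - ζ t|) := by ring
      _ ≤ M ^ 4 * (1 / η) := mul_le_mul M24 (inv_le t ht) (by positivity) (by positivity)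
  have inv_abs : ∀ t ∈ Icc a b, |(z - ζ t)⁻¹| ≤ 1 / η := fun t ht => by
    rw [abs_inv, ← one_div]; exact inv_le t ht
  have la := left_mem_Icc.2 hab
  have lb := right_mem_Icc.2 hab
  have i1 := (abs_le.1 (inv_abs a la)).1
  have i2 := (abs_le.1 (inv_abs b lb)).2
  have i3 : 3 / η * (b - a) ≤ 3 * (1 / η) := by
    calc 3 / η * (b - a) ≤ 3 / η * 1 := by gcongr
      _ = _ := by ring
  have hB : ε / 2 * M ^ 4 * ((z - ζ b)⁻¹ + 3 / η * b) - ε / 2 * M ^ 4 * ((z - ζ a)⁻¹ + 3 / η * a)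
      ≤ ε / 2 * M ^ 4 * (5 * (1 / η)) := by
    rw [← mul_sub]
    refine mul_le_mul_of_nonneg_left ?_ (by positivity)
    linarith
  have hbd : ε / 2 * (|w a| / |(z - ζ a) * ρ a| + |w b| / |(z - ζ b) * ρ b|) ≤
      ε / 2 * (2 * (M ^ 4 * (1 / η))) := by
    refine mul_le_mul_of_nonneg_left ?_ (by positivity)
    linarith [bdry a la, bdry b lb]
  have pos : 0 ≤ M ^ 4 * (ε / η) := by positivity
  -- The two boundary terms contribute `1` and the variation of `B` contributes `5/2`, which the
  -- constant `4` absorbs.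
  have e7 : ε / 2 * (2 * (M ^ 4 * (1 / η))) + ε / 2 * M ^ 4 * (5 * (1 / η)) =
    7 / 2 * (M ^ 4 * (ε / η)) := by ring
  linarith

/-- Adiabatic estimate: if the gap is at least `η` away from a `δ`-neighbourhood of `τ`, the first
coordinate grows by `O(ε / η + δ)`. -/
theorem norm_one_le {p q : ℝ → ℂ} {z η δ τ ε : ℝ}
    (hd : IsGapBounded M ζ ζ' ρ ρ' w w' (Icc 0 1)) (hε : 0 < ε)
    (h : IsAdiabaticPair (fun t => (z - ζ t) * ρ t / ε) w p q (Icc 0 1))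
    (hp1 : ∀ t ∈ Icc (0 : ℝ) 1, ‖p t‖ ≤ 1) (hq1 : ∀ t ∈ Icc (0 : ℝ) 1, ‖q t‖ ≤ 1)
    (hη : 0 < η) (hδ : 0 ≤ δ) (hτ : τ ∈ Icc (0 : ℝ) 1)
    (hgap : ∀ t ∈ Icc (0 : ℝ) 1, δ ≤ |t - τ| → η ≤ |z - ζ t|) :
    ‖p 1‖ ≤ ‖p 0‖ + 8 * M ^ 4 * (ε / η) + 2 * M * δ := by
  have hM0 : 0 < M := by linarith [hd.one_le]
  -- The window around `τ`, cut to `[0, 1]`. If the cut is active, the corresponding outer interval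
  -- is a point and costs nothing.
  set a := max 0 (τ - δ) with ha
  set b := min 1 (τ + δ) with hb
  have pos : 0 ≤ 4 * M ^ 4 * (ε / η) := by positivity
  have a0 : 0 ≤ a := le_max_left _ _
  have b1 : b ≤ 1 := min_le_left _ _
  have aτ : a ≤ τ := max_le hτ.1 (by linarith)
  have τb : τ ≤ b := le_min hτ.2 (by linarith)
  have τa : τ - δ ≤ a := le_max_right _ _
  have bτ : b ≤ τ + δ := min_le_right _ _
  have s1 : ‖p a‖ ≤ ‖p 0‖ + 4 * M ^ 4 * (ε / η) := by
    rcases le_total (τ - δ) 0 with hc | hc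
    · rw [ha, max_eq_left hc]; linarith
    · have sub : Icc 0 a ⊆ Icc (0 : ℝ) 1 := Icc_subset_Icc_right (by linarith [hτ.2])
      have ea : a = τ - δ := max_eq_right hc
      refine (hd.mono sub).norm_le_of_gap_ge hε (h.mono sub) a0 (by linarith [hτ.2])
        (fun t ht => hp1 t (sub ht)) (fun t ht => hq1 t (sub ht)) hη
        (fun t ht => hgap t (sub ht) ?_)
      rw [abs_sub_comm]
      exact le_trans (by linarith [ht.2]) (le_abs_self _)
  have s2 : ‖p b‖ ≤ ‖p a‖ + M * (b - a) := by
    have sub : Icc a b ⊆ Icc (0 : ℝ) 1 := Icc_subset_Icc a0 b1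
    refine (h.mono sub).norm_le_add_mul (by linarith) (fun t ht => ?_)
      (fun t ht => hq1 t (sub ht)) (fun t ht => hd.w_le t (sub ht))
    exact ((((hd.hasDeriv_ζ t (sub ht)).const_sub z).mul
      (hd.hasDeriv_ρ t (sub ht))).continuousWithinAt.mono sub).div_const ε
  have s3 : ‖p 1‖ ≤ ‖p b‖ + 4 * M ^ 4 * (ε / η) := by
    rcases le_total 1 (τ + δ) with hc | hc
    · rw [hb, min_eq_left hc]; linarith
    · have sub : Icc b 1 ⊆ Icc (0 : ℝ) 1 := Icc_subset_Icc_left (by linarith [hτ.1])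
      have eb : b = τ + δ := min_eq_right hc
      refine (hd.mono sub).norm_le_of_gap_ge hε (h.mono sub) b1 (by linarith [hτ.1])
        (fun t ht => hp1 t (sub ht)) (fun t ht => hq1 t (sub ht)) hη
        (fun t ht => hgap t (sub ht) ?_)
      exact le_trans (by linarith [ht.1]) (le_abs_self _)
  have : M * (b - a) ≤ M * (2 * δ) := mul_le_mul_of_nonneg_left (by linarith) hM0.le
  linarith

end IsGapBounded

/-! ### Calculus and compactness on `[0, 1]`. -/

/-- Keeping the time derivative smooth jointly in `(t, z)` allows iteration and, on the compact
rectangle, bounds uniform in `z`. -/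
theorem ContDiffOn.exists_hasDerivWithinAt_fst {F : ℝ × ℝ → ℝ} {z₀ z₁ : ℝ} (hz : z₀ < z₁)
    (hF : ContDiffOn ℝ ∞ F (Icc (0 : ℝ) 1 ×ˢ Icc z₀ z₁)) :
    ∃ F' : ℝ × ℝ → ℝ, ContDiffOn ℝ ∞ F' (Icc (0 : ℝ) 1 ×ˢ Icc z₀ z₁) ∧
      ∀ z ∈ Icc z₀ z₁, ∀ t ∈ Icc (0 : ℝ) 1,
        HasDerivWithinAt (fun s => F (s, z)) (F' (t, z)) (Icc 0 1) t := by
  have hS : UniqueDiffOn ℝ (Icc (0 : ℝ) 1 ×ˢ Icc z₀ z₁) :=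
    (uniqueDiffOn_Icc one_pos).prod (uniqueDiffOn_Icc hz)
  refine ⟨fun x => fderivWithin ℝ F (Icc (0 : ℝ) 1 ×ˢ Icc z₀ z₁) x (1, 0),
    (hF.fderivWithin hS (by simp)).clm_apply contDiffOn_const, fun z hz t ht => ?_⟩
  have h1 := ((hF.differentiableOn (by simp)) (t, z) ⟨ht, hz⟩).hasFDerivWithinAt
  exact h1.comp_hasDerivWithinAt t
    ((hasDerivWithinAt_id t _).prodMk (hasDerivWithinAt_const t _ z)) (fun s hs => mk_mem_prod hs hz)

theorem HasDerivWithinAt.eventually_mul_abs_sub_le {f : ℝ → ℝ} {f' x : ℝ} {s : Set ℝ}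
    (h : HasDerivWithinAt f f' s x) (hf' : f' ≠ 0) :
    ∀ᶠ t in 𝓝[s] x, |f'| / 2 * |t - x| ≤ |f t - f x| := by
  have := (hasDerivWithinAt_iff_isLittleO.1 h).def (half_pos (abs_pos.2 hf'))
  filter_upwards [this] with t ht
  simp only [Real.norm_eq_abs, smul_eq_mul] at ht
  have h2 := abs_sub_abs_le_abs_sub ((t - x) * f') (f t - f x)
  rw [abs_sub_comm _ (f t - f x), abs_mul] at h2
  linarith

/-- Away from `τ`, compactness gives a positive lower bound `μ`, and `(t - τ)² ≤ 1` on the interval.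
-/
theorem exists_mul_sq_le_of_pos {F : ℝ → ℝ} {τ c : ℝ} (hτ : τ ∈ Icc (0 : ℝ) 1)
    (hF : ContinuousOn F (Icc 0 1)) (hpos : ∀ t ∈ Icc (0 : ℝ) 1, t ≠ τ → 0 < F t) (hc : 0 < c)
    (hnear : ∀ᶠ t in 𝓝[Icc 0 1] τ, c * (t - τ) ^ 2 ≤ F t) :
    ∃ c' > 0, ∀ t ∈ Icc (0 : ℝ) 1, c' * (t - τ) ^ 2 ≤ F t := by
  obtain ⟨r, hr, hball⟩ := Metric.mem_nhdsWithin_iff.1 hnear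
  have hK : IsCompact (Icc (0 : ℝ) 1 \ Metric.ball τ r) := isCompact_Icc.diff Metric.isOpen_ball
  obtain ⟨μ, hμ, hmin⟩ := hK.exists_forall_le' (hF.mono sdiff_subset) (a := 0)
    (fun t ht => hpos t ht.1 fun h => ht.2 (h ▸ Metric.mem_ball_self hr))
  refine ⟨min c μ, lt_min hc hμ, fun t ht => ?_⟩
  by_cases hb : t ∈ Metric.ball τ r
  · exact (mul_le_mul_of_nonneg_right (min_le_left _ _) (sq_nonneg _)).trans (hball ⟨hb, ht⟩)
  · refine le_trans ?_ (hmin t ⟨ht, hb⟩)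
    have h1 : (t - τ) ^ 2 ≤ 1 := by
      rw [sq_le_one_iff_abs_le_one, abs_le]
      constructor <;> linarith [ht.1, ht.2, hτ.1, hτ.2]
    exact (mul_le_of_le_one_right (lt_min hc hμ).le h1).trans (min_le_right _ _)

/-- `|F s - F t|` is positive on the compact set of pairs at distance at least `δ`. -/
theorem ContinuousOn.exists_separation {F : ℝ → ℝ} (hF : ContinuousOn F (Icc 0 1))
    (hinj : InjOn F (Icc 0 1)) {δ : ℝ} (hδ : 0 < δ) :
    ∃ η > 0, ∀ s ∈ Icc (0 : ℝ) 1, ∀ t ∈ Icc (0 : ℝ) 1, δ ≤ |s - t| → η ≤ |F s - F t| := by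
  have hK : IsCompact ((Icc (0 : ℝ) 1 ×ˢ Icc (0 : ℝ) 1) ∩ {x : ℝ × ℝ | δ ≤ |x.1 - x.2|}) :=
    (isCompact_Icc.prod isCompact_Icc).inter_right
      (isClosed_le continuous_const (by fun_prop))
  have hc : ContinuousOn (fun x : ℝ × ℝ => |F x.1 - F x.2|)
      ((Icc (0 : ℝ) 1 ×ˢ Icc (0 : ℝ) 1) ∩ {x : ℝ × ℝ | δ ≤ |x.1 - x.2|}) :=
    ((hF.comp continuousOn_fst fun x hx => hx.1.1).sub
      (hF.comp continuousOn_snd fun x hx => hx.1.2)).abs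
  obtain ⟨η, hη, hmin⟩ := hK.exists_forall_le' hc (a := 0) (fun x hx => abs_pos.2 fun h => by
    have h1 : x.1 = x.2 := hinj hx.1.1 hx.1.2 (sub_eq_zero.1 h)
    have h2 : δ ≤ |x.1 - x.2| := hx.2
    rw [h1, sub_self, abs_zero] at h2
    linarith)
  exact ⟨η, hη, fun s hs t ht hst => hmin (s, t) ⟨⟨hs, ht⟩, hst⟩⟩

theorem ContinuousOn.pos_or_neg_of_ne_zero {F : ℝ → ℝ} (hF : ContinuousOn F (Icc 0 1))
    (h0 : ∀ t ∈ Icc (0 : ℝ) 1, F t ≠ 0) :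
    (∀ t ∈ Icc (0 : ℝ) 1, 0 < F t) ∨ ∀ t ∈ Icc (0 : ℝ) 1, F t < 0 := by
  by_contra! hcon
  obtain ⟨⟨s, hs, hFs⟩, t, ht, hFt⟩ := hcon
  obtain ⟨x, hx, hFx⟩ := isPreconnected_Icc.intermediate_value hs ht hF ⟨hFs, hFt⟩
  exact h0 x hx hFx

/-! ### Geometry of the crossing curve above the path. -/

namespace SemiConical

variable {h₁ h₂ : ℝ × ℝ × ℝ → ℝ} {m : ℝ → ℝ} {U : Set (ℝ × ℝ)} {z₀ z₁ : ℝ} {u v : ℝ → ℝ}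

theorem eq_of_normalForm_eq_zero {p : ℝ × ℝ × ℝ} (hp : h₁ p * h₂ p ≠ 0)
    (h : normalForm h₁ h₂ m p = 0) :
    p.2.2 = m p.1 * p.1 ∧ p.2.2 = -p.1 - p.2.1 ^ 2 := by
  have h1 : h₁ p * (p.2.2 - m p.1 * p.1) = 0 := congrArg Prod.fst h
  have h2 : h₂ p * (p.2.2 + p.1 + p.2.1 ^ 2) = 0 := congrArg Prod.snd h
  have h1' := (mul_eq_zero.1 h1).resolve_left (left_ne_zero_of_mul hp)
  have h2' := (mul_eq_zero.1 h2).resolve_left (right_ne_zero_of_mul hp)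
  constructor <;> linarith

/-- On the crossing set both linear factors vanish, so the derivatives of `h₁` and `h₂` drop out. At
the conical starting point the formula yields `v ≠ 0` and a nonzero derivative of `m(u)u`. -/
theorem jacobian_normalForm {p : ℝ × ℝ × ℝ} (smooth_h₁ : ContDiff ℝ ∞ h₁)
    (smooth_h₂ : ContDiff ℝ ∞ h₂) (smooth_m : ContDiff ℝ ∞ m)
    (hz1 : p.2.2 = m p.1 * p.1) (hz2 : p.2.2 = -p.1 - p.2.1 ^ 2) :
    jacobian (normalForm h₁ h₂ m) p =
      -(h₁ p * h₂ p) * (deriv m p.1 * p.1 + m p.1) * (2 * p.2.1) := by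
  obtain ⟨a, b, c⟩ := p
  simp only at hz1 hz2
  have d1 : Differentiable ℝ h₁ := smooth_h₁.differentiable (by simp)
  have d2 : Differentiable ℝ h₂ := smooth_h₂.differentiable (by simp)
  have dm : HasDerivAt m (deriv m a) a := (smooth_m.differentiable (by simp) a).hasDerivAt
  have h1a : DifferentiableAt ℝ (fun s => h₁ (s, b, c)) a := by fun_prop
  have h2a : DifferentiableAt ℝ (fun s => h₂ (s, b, c)) a := by fun_prop
  have h1b : DifferentiableAt ℝ (fun s => h₁ (a, s, c)) b := by fun_prop
  have h2b : DifferentiableAt ℝ (fun s => h₂ (a, s, c)) b := by fun_prop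
  have e1 : partial₁ (normalForm h₁ h₂ m) (a, b, c) =
      (-(h₁ (a, b, c) * (deriv m a * a + m a)), h₂ (a, b, c)) := by
    refine HasDerivAt.deriv (HasDerivAt.prodMk ?_ ?_)
    · refine (h1a.hasDerivAt.mul ((dm.mul (hasDerivAt_id a)).const_sub c)).congr_deriv ?_
      simp [hz1]
      ring
    · refine (h2a.hasDerivAt.mul (((hasDerivAt_id a).const_add c).add_const (b ^ 2))).congr_deriv ?_
      simp [show c + a + b ^ 2 = 0 by linarith]
  have e2 : partial₂ (normalForm h₁ h₂ m) (a, b, c) = (0, h₂ (a, b, c) * (2 * b)) := by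
    refine HasDerivAt.deriv (HasDerivAt.prodMk ?_ ?_)
    · refine (h1b.hasDerivAt.mul_const (c - m a * a)).congr_deriv ?_
      simp [hz1]
    · refine (h2b.hasDerivAt.mul (((hasDerivAt_id b).pow 2).const_add (c + a))).congr_deriv ?_
      simp [show c + a + b ^ 2 = 0 by linarith]
  rw [jacobian, e1, e2]
  ring

/-- The level of the crossing point above a point of the path. -/
def level (u v : ℝ → ℝ) (t : ℝ) : ℝ := -u t - v t ^ 2

/-- What is used of a path which stays under the crossing set. -/
structure IsCrossingPath (m : ℝ → ℝ) (U : Set (ℝ × ℝ)) (z₀ z₁ : ℝ) (u v : ℝ → ℝ) : Prop where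
  mem_U : ∀ t ∈ Icc (0 : ℝ) 1, (u t, v t) ∈ U
  level_mem : ∀ t ∈ Icc (0 : ℝ) 1, level u v t ∈ Icc z₀ z₁
  mul_eq_level : ∀ t ∈ Icc (0 : ℝ) 1, m (u t) * u t = level u v t
  level_start : level u v 0 = z₀
  level_final : level u v 1 = 0

theorem ConditionC.isCrossingPath (condC : ConditionC (normalForm h₁ h₂ m) U z₀ z₁ u v)
    (h_ne : ∀ u v z : ℝ, (u, v) ∈ U → z ∈ Icc z₀ z₁ → h₁ (u, v, z) * h₂ (u, v, z) ≠ 0) :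
    IsCrossingPath m U z₀ z₁ u v := by
  have key : ∀ t z, (u t, v t, z) ∈ crossingSet (normalForm h₁ h₂ m) U z₀ z₁ →
      z = m (u t) * u t ∧ z = level u v t := fun t z h =>
    eq_of_normalForm_eq_zero (h_ne _ _ _ h.2.1 h.2.2) h.1
  refine ⟨fun t ht => ?_, fun t ht => ?_, fun t ht => ?_, (key 0 z₀ condC.start_mem).2.symm, ?_⟩
  · obtain ⟨z, hz⟩ := condC.mem_proj t ht
    exact hz.2.1
  · obtain ⟨z, hz⟩ := condC.mem_proj t ht
    exact (key t z hz).2 ▸ hz.2.2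
  · obtain ⟨z, hz⟩ := condC.mem_proj t ht
    exact (key t z hz).1.symm.trans (key t z hz).2
  · simp [level, condC.final_u, condC.final_v]

theorem IsRegularSmoothPath.contDiffOn_level (path : IsRegularSmoothPath u v) :
    ContDiffOn ℝ ∞ (level u v) (Icc 0 1) :=
  path.smooth_u.neg.sub (path.smooth_v.pow 2)

theorem IsRegularSmoothPath.hasDeriv (path : IsRegularSmoothPath u v) {t : ℝ}
    (ht : t ∈ Icc (0 : ℝ) 1) : ∃ u' v' : ℝ, HasDerivWithinAt u u' (Icc 0 1) t ∧
      HasDerivWithinAt v v' (Icc 0 1) t ∧ (u' = 0 → v' ≠ 0) := by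
  refine ⟨_, _, (path.smooth_u.differentiableOn (by simp) t ht).hasDerivWithinAt,
    (path.smooth_v.differentiableOn (by simp) t ht).hasDerivWithinAt, fun h1 h2 => ?_⟩
  exact path.regular t ht (by rw [h1, h2])

theorem hasDerivWithinAt_level {s : Set ℝ} {u' v' t : ℝ} (hu : HasDerivWithinAt u u' s t)
    (hv : HasDerivWithinAt v v' s t) :
    HasDerivWithinAt (level u v) (-u' - 2 * v t * v') s t := by
  refine (hu.neg.sub (hv.pow 2)).congr_deriv ?_
  simp

namespace IsCrossingPath

theorem mem_crossingSet (hp : IsCrossingPath m U z₀ z₁ u v) {t : ℝ} (ht : t ∈ Icc (0 : ℝ) 1) :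
    (u t, v t, level u v t) ∈ crossingSet (normalForm h₁ h₂ m) U z₀ z₁ := by
  refine ⟨?_, hp.mem_U t ht, hp.level_mem t ht⟩
  have := hp.mul_eq_level t ht
  have h2 : level u v t + u t + v t ^ 2 = 0 := by simp only [level]; ring
  simp [normalForm, this, h2]

/-- The level has the two expressions `m(u)u` and `-u - v²`; their time derivatives agree. -/
theorem deriv_eq (hp : IsCrossingPath m U z₀ z₁ u v)
    (smooth_m : ContDiff ℝ ∞ m) {t u' v' : ℝ} (ht : t ∈ Icc (0 : ℝ) 1)
    (hu : HasDerivWithinAt u u' (Icc 0 1) t) (hv : HasDerivWithinAt v v' (Icc 0 1) t) :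
    (deriv m (u t) * u t + m (u t)) * u' = -u' - 2 * v t * v' := by
  have dm : HasDerivAt m (deriv m (u t)) (u t) :=
    (smooth_m.differentiable (by simp) (u t)).hasDerivAt
  have h1 := (dm.comp_hasDerivWithinAt t hu).mul hu
  have h2 : HasDerivWithinAt (level u v) (deriv m (u t) * u' * u t + m (u t) * u') (Icc 0 1) t :=
    h1.congr (fun s hs => (hp.mul_eq_level s hs).symm) (hp.mul_eq_level t ht).symm
  have := (uniqueDiffOn_Icc one_pos t ht).eq_deriv _ h2 (hasDerivWithinAt_level hu hv)
  linarith

/-- Uniqueness of crossing times is only available for levels at most `0`. A positive level at `t`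
would force a zero of the level before `t`, hence a second crossing time for `z = 0` besides `1`. So
the level is nonpositive, therefore injective, therefore strictly monotone, and its end values
decide the direction. -/
theorem strictMonoOn_level (hp : IsCrossingPath m U z₀ z₁ u v)
    (path : IsRegularSmoothPath u v) (z₀_neg : z₀ < 0)
    (hunique : ∀ z ∈ Icc z₀ 0, ∀ s ∈ Icc (0 : ℝ) 1, ∀ t ∈ Icc (0 : ℝ) 1,
      (u s, v s, z) ∈ crossingSet (normalForm h₁ h₂ m) U z₀ z₁ →
      (u t, v t, z) ∈ crossingSet (normalForm h₁ h₂ m) U z₀ z₁ → s = t) :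
    StrictMonoOn (level u v) (Icc 0 1) := by
  have i0 : (0 : ℝ) ∈ Icc (0 : ℝ) 1 := by simp
  have i1 : (1 : ℝ) ∈ Icc (0 : ℝ) 1 := by simp
  have hc := path.contDiffOn_level.continuousOn
  have uniq : ∀ s ∈ Icc (0 : ℝ) 1, ∀ t ∈ Icc (0 : ℝ) 1, level u v s = level u v t →
      level u v s ≤ 0 → s = t := fun s hs t ht hst hs0 =>
    hunique _ ⟨(hp.level_mem s hs).1, hs0⟩ s hs t ht (hp.mem_crossingSet hs)
      (hst ▸ hp.mem_crossingSet ht)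
  have nonpos : ∀ t ∈ Icc (0 : ℝ) 1, level u v t ≤ 0 := by
    intro t ht
    by_contra! hcon
    obtain ⟨s, hs, hs0⟩ := intermediate_value_Icc ht.1 (hc.mono (Icc_subset_Icc_right ht.2))
      ⟨hp.level_start.le.trans z₀_neg.le, hcon.le⟩
    have := uniq s ⟨hs.1, hs.2.trans ht.2⟩ 1 i1 (hs0.trans hp.level_final.symm) hs0.le
    have ht1 : t = 1 := le_antisymm ht.2 (this ▸ hs.2)
    rw [ht1, hp.level_final] at hcon
    exact lt_irrefl _ hcon
  rcases hc.strictMonoOn_of_injOn_Icc' zero_le_one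
    (fun s hs t ht hst => uniq s hs t ht hst (nonpos s hs)) with h | h
  · exact h
  · have := h i0 i1 one_pos
    rw [hp.level_start, hp.level_final] at this
    exact absurd this z₀_neg.not_gt

/-- Quadratic contact of the crossing curve with the level `0` at the end of the path. -/
theorem exists_mul_sq_le_neg_level (hp : IsCrossingPath m U z₀ z₁ u v)
    (smooth_m : ContDiff ℝ ∞ m) (path : IsRegularSmoothPath u v)
    (m_zero : m 0 ≠ -1 ∧ m 0 ≠ 0) (hu1 : u 1 = 0) (hv1 : v 1 = 0)
    (hmono : StrictMonoOn (level u v) (Icc 0 1)) :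
    ∃ c > 0, ∀ t ∈ Icc (0 : ℝ) 1, c * (t - 1) ^ 2 ≤ -level u v t := by
  have i1 : (1 : ℝ) ∈ Icc (0 : ℝ) 1 := by simp
  obtain ⟨u', v', hu, hv, hreg⟩ := path.hasDeriv i1
  have hm1 : 1 + m 0 ≠ 0 := fun h => m_zero.1 (by linarith)
  -- At the origin the tangent relation reads `(1 + m(0))u' = 0`, so the path arrives along the
  -- `v`-axis.
  have hv' : v' ≠ 0 := by
    refine hreg ((mul_eq_zero.1 (?_ : (1 + m 0) * u' = 0)).resolve_left hm1)
    have := hp.deriv_eq smooth_m i1 hu hv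
    rw [hu1, hv1] at this
    linarith
  have hpos : ∀ t ∈ Icc (0 : ℝ) 1, t ≠ 1 → 0 < -level u v t := fun t ht h1 => by
    have := hmono ht i1 (lt_of_le_of_ne ht.2 h1)
    rw [hp.level_final] at this
    linarith
  set a := |m 0| / 2
  set b := |1 + m 0| + 1
  have ha : 0 < a := half_pos (abs_pos.2 m_zero.2)
  have hb : 0 < b := by positivity
  have hv'a : 0 < |v'| / 2 := half_pos (abs_pos.2 hv')
  refine exists_mul_sq_le_of_pos (c := a * (|v'| / 2) ^ 2 / b) i1
    path.contDiffOn_level.continuousOn.neg hpos (by positivity) ?_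
  have hmu : Tendsto (fun t => m (u t)) (𝓝[Icc 0 1] 1) (𝓝 (m 0)) := by
    have := (smooth_m.continuous.tendsto (u 1)).comp hu.continuousWithinAt
    rwa [hu1] at this
  have ev1 : ∀ᶠ t in 𝓝[Icc 0 1] 1, a < |m (u t)| :=
    hmu.abs.eventually (lt_mem_nhds (half_lt_self (abs_pos.2 m_zero.2)))
  have ev2 : ∀ᶠ t in 𝓝[Icc 0 1] 1, |1 + m (u t)| < b :=
    (hmu.const_add 1).abs.eventually (gt_mem_nhds (lt_add_one _))
  filter_upwards [ev1, ev2, hv.eventually_mul_abs_sub_le hv', self_mem_nhdsWithin]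
    with t h1 h2 h3 ht
  rw [hv1, sub_zero] at h3
  have hnn : 0 ≤ -level u v t := by
    rcases eq_or_ne t 1 with rfl | hne
    · rw [hp.level_final, neg_zero]
    · exact (hpos t ht hne).le
  -- Eliminating `u` between `ζ = m u` and `ζ = -u - v²` gives `(1 + m)(-ζ) = m v²`: the level is
  -- comparable to `v²`, hence to `(t - 1)²`.
  have e1 : |1 + m (u t)| * (-level u v t) = |m (u t)| * v t ^ 2 := by
    rw [← abs_of_nonneg hnn, ← abs_mul, ← abs_of_nonneg (sq_nonneg (v t)), ← abs_mul]
    congr 1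
    have hl := hp.mul_eq_level t ht
    rw [← hl]
    simp only [level] at hl
    linear_combination (-m (u t)) * hl
  have e2 : (|v'| / 2 * |t - 1|) ^ 2 ≤ v t ^ 2 := by
    rw [← sq_abs (v t)]
    exact pow_le_pow_left₀ (by positivity) h3 2
  rw [mul_pow, sq_abs] at e2
  rw [div_mul_eq_mul_div, div_le_iff₀ hb]
  calc a * (|v'| / 2) ^ 2 * (t - 1) ^ 2 = a * ((|v'| / 2) ^ 2 * (t - 1) ^ 2) := by ring
    _ ≤ |m (u t)| * v t ^ 2 := mul_le_mul h1.le e2 (by positivity) (abs_nonneg _)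
    _ = |1 + m (u t)| * (-level u v t) := e1.symm
    _ ≤ b * (-level u v t) := mul_le_mul_of_nonneg_right h2.le hnn
    _ = _ := mul_comm _ _

/-- The crossing curve leaves the initial F-conical point transversally to the level `z₀`. -/
theorem exists_mul_sq_le_level_sub (hp : IsCrossingPath m U z₀ z₁ u v)
    (smooth_h₁ : ContDiff ℝ ∞ h₁) (smooth_h₂ : ContDiff ℝ ∞ h₂)
    (smooth_m : ContDiff ℝ ∞ m) (path : IsRegularSmoothPath u v)
    (hjac : jacobian (normalForm h₁ h₂ m) (u 0, v 0, z₀) ≠ 0)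
    (hmono : StrictMonoOn (level u v) (Icc 0 1)) :
    ∃ c > 0, ∀ t ∈ Icc (0 : ℝ) 1, c * (t - 0) ^ 2 ≤ level u v t - z₀ := by
  have i0 : (0 : ℝ) ∈ Icc (0 : ℝ) 1 := by simp
  obtain ⟨u', v', hu, hv, hreg⟩ := path.hasDeriv i0
  rw [jacobian_normalForm smooth_h₁ smooth_h₂ smooth_m
    (by simp only; rw [hp.mul_eq_level 0 i0, hp.level_start])
    (by simp only; rw [← hp.level_start, level])] at hjac
  have hv0 : v 0 ≠ 0 := fun h => by simp [h] at hjac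
  have hd : deriv m (u 0) * u 0 + m (u 0) ≠ 0 := fun h => by simp [h] at hjac
  have heq := hp.deriv_eq smooth_m i0 hu hv
  -- If `u' = 0`, the tangent relation leaves `v(0)v' = 0`, contradicting `v(0) ≠ 0` and the
  -- regularity of the path.
  have hu' : u' ≠ 0 := fun h => by
    have := hreg h
    rw [h] at heq
    simp [hv0, this] at heq
  have hl' : -u' - 2 * v 0 * v' ≠ 0 := heq ▸ mul_ne_zero hd hu'
  refine exists_mul_sq_le_of_pos (c := |-u' - 2 * v 0 * v'| / 2) i0
    (path.contDiffOn_level.continuousOn.sub continuousOn_const) (fun t ht h0 => ?_)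
    (half_pos (abs_pos.2 hl')) ?_
  · have := hmono i0 ht (lt_of_le_of_ne ht.1 h0.symm)
    rw [hp.level_start] at this
    linarith
  · filter_upwards [(hasDerivWithinAt_level hu hv).eventually_mul_abs_sub_le hl',
      self_mem_nhdsWithin] with t h1 ht
    have h2 : 0 ≤ level u v t - z₀ := sub_nonneg.2 (hp.level_mem t ht).1
    rw [hp.level_start, abs_of_nonneg h2, sub_zero, abs_of_nonneg ht.1] at h1
    refine le_trans ?_ h1
    -- The growth is linear here; it is weakened to quadratic so that both ends of the path have the
    -- same form of bound.
    have : t ^ 2 ≤ t := by nlinarith [ht.1, ht.2]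
    rw [sub_zero]
    gcongr

end IsCrossingPath

end SemiConical

/-! ### Smooth diagonalization along the path. -/

namespace SemiConical

variable {h₁ h₂ : ℝ × ℝ × ℝ → ℝ} {m : ℝ → ℝ} {U : Set (ℝ × ℝ)} {z₀ z₁ : ℝ} {u v : ℝ → ℝ}

/-- Along the path, `H_f = (z - ζ) ρ [[cos θ, sin θ], [sin θ, -cos θ]]`, where `ζ` is the level
of the crossing and `ρ > 0`, with bounds on all the data. -/
structure IsRotatingFrame (f : ℝ × ℝ × ℝ → ℝ × ℝ) (u v : ℝ → ℝ) (z M : ℝ)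
    (ζ' θ ρ ρ' w w' : ℝ → ℝ) : Prop where
  pos : ∀ t ∈ Icc (0 : ℝ) 1, 0 < ρ t
  hasDeriv_θ : ∀ t ∈ Icc (0 : ℝ) 1, HasDerivWithinAt θ (2 * w t) (Icc 0 1) t
  bounded : IsGapBounded M (level u v) ζ' ρ ρ' w w' (Icc 0 1)
  fst_eq : ∀ t ∈ Icc (0 : ℝ) 1,
    (f (u t, v t, z)).1 = (z - level u v t) * ρ t * Real.cos (θ t)
  snd_eq : ∀ t ∈ Icc (0 : ℝ) 1,
    (f (u t, v t, z)).2 = (z - level u v t) * ρ t * Real.sin (θ t)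

/-- Along the path `f = (z - ζ)(h₁, h₂)`. With `X = h₂/h₁`, this vector is `h₁√(1 + X²)` times
`(cos, sin)` of `arctan X`. The bound `M` is chosen before `z`, which is the source of all
uniformity. -/
theorem exists_isRotatingFrame (smooth_h₁ : ContDiff ℝ ∞ h₁) (smooth_h₂ : ContDiff ℝ ∞ h₂)
    (hz : z₀ < z₁) (path : IsRegularSmoothPath u v) (hp : IsCrossingPath m U z₀ z₁ u v)
    (hmono : StrictMonoOn (level u v) (Icc 0 1))
    (h_ne : ∀ u v z : ℝ, (u, v) ∈ U → z ∈ Icc z₀ z₁ → h₁ (u, v, z) ≠ 0) :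
    ∃ M : ℝ, ∃ ζ' : ℝ → ℝ, ∀ z ∈ Icc z₀ z₁, ∃ θ ρ ρ' w w' : ℝ → ℝ,
      IsRotatingFrame (normalForm h₁ h₂ m) u v z M ζ' θ ρ ρ' w w' := by
  set S := Icc (0 : ℝ) 1 ×ˢ Icc z₀ z₁
  have hS : IsCompact S := isCompact_Icc.prod isCompact_Icc
  have hγ : ContDiffOn ℝ ∞ (fun x : ℝ × ℝ => (u x.1, v x.1, x.2)) S :=
    (path.smooth_u.comp contDiffOn_fst fun x hx => hx.1).prodMk
      ((path.smooth_v.comp contDiffOn_fst fun x hx => hx.1).prodMk contDiffOn_snd)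
  have s1 : ContDiffOn ℝ ∞ (fun x : ℝ × ℝ => h₁ (u x.1, v x.1, x.2)) S :=
    smooth_h₁.comp_contDiffOn hγ
  have s2 : ContDiffOn ℝ ∞ (fun x : ℝ × ℝ => h₂ (u x.1, v x.1, x.2)) S :=
    smooth_h₂.comp_contDiffOn hγ
  have n1 : ∀ x ∈ S, h₁ (u x.1, v x.1, x.2) ≠ 0 := fun x hx =>
    h_ne _ _ _ (hp.mem_U _ hx.1) hx.2
  have s3 := s2.div s1 n1
  set X : ℝ × ℝ → ℝ := fun x => h₂ (u x.1, v x.1, x.2) / h₁ (u x.1, v x.1, x.2) with hX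
  set T : ℝ × ℝ → ℝ := fun x => Real.arctan (X x)
  set Rho : ℝ × ℝ → ℝ := fun x => h₁ (u x.1, v x.1, x.2) * √(1 + X x ^ 2) with hRho
  have sT : ContDiffOn ℝ ∞ T S := Real.contDiff_arctan.comp_contDiffOn s3
  have sRho : ContDiffOn ℝ ∞ Rho S :=
    s1.mul ((contDiffOn_const.add (s3.pow 2)).sqrt fun x _ => by positivity)
  have nRho : ∀ x ∈ S, Rho x ≠ 0 := fun x hx => mul_ne_zero (n1 x hx) (by positivity)
  obtain ⟨T₁, sT₁, dT⟩ := sT.exists_hasDerivWithinAt_fst hz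
  obtain ⟨T₂, sT₂, dT₁⟩ := sT₁.exists_hasDerivWithinAt_fst hz
  obtain ⟨Rho₁, sRho₁, dRho⟩ := sRho.exists_hasDerivWithinAt_fst hz
  obtain ⟨C₁, hC₁⟩ := hS.exists_bound_of_continuousOn sT₁.continuousOn
  obtain ⟨C₂, hC₂⟩ := hS.exists_bound_of_continuousOn sT₂.continuousOn
  obtain ⟨C₃, hC₃⟩ := hS.exists_bound_of_continuousOn sRho.continuousOn
  obtain ⟨C₄, hC₄⟩ := hS.exists_bound_of_continuousOn sRho₁.continuousOn
  obtain ⟨C₅, hC₅⟩ := hS.exists_bound_of_continuousOn (sRho.continuousOn.inv₀ nRho)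
  -- `C₅` bounds `1/ρ`, which gives the lower bound on `|ρ|`.
  set M := 1 + |C₁| + |C₂| + |C₃| + |C₄| + |C₅|
  have p1 := abs_nonneg C₁
  have p2 := abs_nonneg C₂
  have p3 := abs_nonneg C₃
  have p4 := abs_nonneg C₄
  have p5 := abs_nonneg C₅
  refine ⟨M, derivWithin (level u v) (Icc 0 1), fun z hzz => ?_⟩
  have hbd : IsGapBounded M (level u v) (derivWithin (level u v) (Icc 0 1))
      (fun t => Rho (t, z)) (fun t => Rho₁ (t, z)) (fun t => T₁ (t, z) / 2)
      (fun t => T₂ (t, z) / 2) (Icc 0 1) := by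
    have memS : ∀ t ∈ Icc (0 : ℝ) 1, (t, z) ∈ S := fun t ht => mk_mem_prod ht hzz
    refine ⟨by linarith, fun t ht => ?_, dRho z hzz, fun t ht => (dT₁ z hzz t ht).div_const 2,
      fun t _ => hmono.monotoneOn.derivWithin_nonneg, fun t ht => ?_, fun t ht => ?_,
      fun t ht => ?_, fun t ht => ?_, fun t ht => ?_⟩
    · exact (path.contDiffOn_level.differentiableOn (by simp) t ht).hasDerivWithinAt
    · have h5 := hC₅ _ (memS t ht)
      have hpos := abs_pos.2 (nRho _ (memS t ht))
      rw [Real.norm_eq_abs, Pi.inv_apply, abs_inv] at h5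
      rw [← inv_mul_cancel₀ hpos.ne']
      refine mul_le_mul_of_nonneg_right ?_ hpos.le
      linarith [le_abs_self C₅]
    · have := hC₃ _ (memS t ht)
      rw [Real.norm_eq_abs] at this
      linarith [le_abs_self C₃]
    · have := hC₄ _ (memS t ht)
      rw [Real.norm_eq_abs] at this
      linarith [le_abs_self C₄]
    · have := hC₁ _ (memS t ht)
      rw [Real.norm_eq_abs] at this
      rw [abs_div, abs_two]
      linarith [le_abs_self C₁]
    · have := hC₂ _ (memS t ht)
      rw [Real.norm_eq_abs] at this
      rw [abs_div, abs_two]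
      linarith [le_abs_self C₂]
  have e1 : ∀ t ∈ Icc (0 : ℝ) 1, (normalForm h₁ h₂ m (u t, v t, z)).1 =
      (z - level u v t) * Rho (t, z) * Real.cos (T (t, z)) := fun t ht => by
    have : (normalForm h₁ h₂ m (u t, v t, z)).1 = h₁ (u t, v t, z) * (z - level u v t) := by
      rw [← hp.mul_eq_level t ht]; rfl
    rw [this, Real.cos_arctan]
    simp only [Rho]
    field_simp
  have e2 : ∀ t ∈ Icc (0 : ℝ) 1, (normalForm h₁ h₂ m (u t, v t, z)).2 =
      (z - level u v t) * Rho (t, z) * Real.sin (T (t, z)) := fun t ht => by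
    have h0 : h₁ (u t, v t, z) ≠ 0 := n1 (t, z) ⟨ht, hzz⟩
    have : (normalForm h₁ h₂ m (u t, v t, z)).2 = h₂ (u t, v t, z) * (z - level u v t) := by
      simp only [normalForm, level]; ring
    have hXe : h₂ (u t, v t, z) = X (t, z) * h₁ (u t, v t, z) := by
      simp only [X]; field_simp
    rw [this, Real.sin_arctan, hXe]
    simp only [Rho]
    field_simp
  have dθ : ∀ t ∈ Icc (0 : ℝ) 1,
      HasDerivWithinAt (fun t => T (t, z)) (2 * (T₁ (t, z) / 2)) (Icc 0 1) t := fun t ht => by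
    rw [mul_div_cancel₀ _ two_ne_zero]
    exact dT z hzz t ht
  -- `ρ` has the sign of `h₁`, constant along the path; if it is negative, it is reversed by adding
  -- `π` to the angle.
  rcases ContinuousOn.pos_or_neg_of_ne_zero (F := fun t => Rho (t, z))
    (fun t ht => (dRho z hzz t ht).continuousWithinAt) (fun t ht => nRho _ ⟨ht, hzz⟩)
    with hpos | hneg
  · exact ⟨_, _, _, _, _, hpos, dθ, hbd, e1, e2⟩
  · refine ⟨fun t => T (t, z) + Real.pi, fun t => -Rho (t, z), fun t => -Rho₁ (t, z), _, _,
      fun t ht => neg_pos.2 (hneg t ht), fun t ht => (dθ t ht).add_const _,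
      ⟨hbd.one_le, hbd.hasDeriv_ζ, hbd.neg.hasDeriv_ρ, hbd.hasDeriv_w, hbd.nonneg_ζ',
        hbd.neg.one_le_ρ, hbd.neg.ρ_le, hbd.neg.ρ'_le, hbd.w_le, hbd.w'_le⟩,
      fun t ht => ?_, fun t ht => ?_⟩
    · rw [e1 t ht, Real.cos_add_pi]; ring
    · rw [e2 t ht, Real.sin_add_pi]; ring

/-! ### Coordinates of states and eigenvectors in the frame. -/

/-- The coordinate of a state on the eigenvector `(cos (θ/2), sin (θ/2))`. -/
noncomputable def cosCoord (θ : ℝ) (x : EuclideanSpace ℂ (Fin 2)) : ℂ :=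
  (Real.cos (θ / 2) : ℂ) * x 0 + (Real.sin (θ / 2) : ℂ) * x 1

/-- The coordinate of a state on the eigenvector `(-sin (θ/2), cos (θ/2))`. -/
noncomputable def sinCoord (θ : ℝ) (x : EuclideanSpace ℂ (Fin 2)) : ℂ :=
  -(Real.sin (θ / 2) : ℂ) * x 0 + (Real.cos (θ / 2) : ℂ) * x 1

theorem norm_cosCoord_sq_add (θ : ℝ) (x : EuclideanSpace ℂ (Fin 2)) :
    ‖cosCoord θ x‖ ^ 2 + ‖sinCoord θ x‖ ^ 2 = ‖x‖ ^ 2 := by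
  rw [EuclideanSpace.norm_sq_eq, Fin.sum_univ_two]
  simp only [cosCoord, sinCoord, ← Complex.normSq_eq_norm_sq, Complex.normSq_apply,
    Complex.add_re, Complex.add_im, Complex.mul_re, Complex.mul_im, Complex.neg_re,
    Complex.neg_im, Complex.ofReal_re, Complex.ofReal_im]
  have := Real.sin_sq_add_cos_sq (θ / 2)
  linear_combination ((x 0).re ^ 2 + (x 0).im ^ 2 + (x 1).re ^ 2 + (x 1).im ^ 2) * this

theorem norm_toState (x : EuclideanSpace ℝ (Fin 2)) : ‖toState x‖ = ‖x‖ := by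
  rw [EuclideanSpace.norm_eq, EuclideanSpace.norm_eq]
  simp [toState]

theorem inner_toState (θ : ℝ) (y : EuclideanSpace ℂ (Fin 2)) (x : EuclideanSpace ℝ (Fin 2)) :
    inner ℂ y (toState x) = starRingEnd ℂ (cosCoord θ y) * cosCoord θ (toState x) +
      starRingEnd ℂ (sinCoord θ y) * sinCoord θ (toState x) := by
  rw [PiLp.inner_apply, Fin.sum_univ_two]
  simp only [cosCoord, sinCoord, RCLike.inner_apply, map_add, map_mul, map_neg, Complex.conj_ofReal]
  have : (Real.sin (θ / 2) : ℂ) ^ 2 + (Real.cos (θ / 2) : ℂ) ^ 2 = 1 := by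
    exact_mod_cast Real.sin_sq_add_cos_sq (θ / 2)
  linear_combination (-(starRingEnd ℂ (y 0) * toState x 0 + starRingEnd ℂ (y 1) * toState x 1))
    * this

/-- A real unit vector with one zero coordinate has the other of modulus `1`, so the overlap reduces
to one coordinate of the state. -/
theorem transition_of_cosCoord_eq_zero {ψ : ℝ → EuclideanSpace ℂ (Fin 2)} {ε θ : ℝ}
    {x : EuclideanSpace ℝ (Fin 2)} (hx : ‖x‖ = 1) (h : cosCoord θ (toState x) = 0) :
    transition ψ ε x = ‖sinCoord θ (ψ (1 / ε))‖ := by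
  have h1 := norm_cosCoord_sq_add θ (toState x)
  rw [h, norm_toState, hx, norm_zero] at h1
  have h2 : ‖sinCoord θ (toState x)‖ = 1 := by
    nlinarith [norm_nonneg (sinCoord θ (toState x))]
  rw [transition, inner_toState θ, h, mul_zero, zero_add, norm_mul, h2, mul_one, RCLike.norm_conj]

theorem transition_of_sinCoord_eq_zero {ψ : ℝ → EuclideanSpace ℂ (Fin 2)} {ε θ : ℝ}
    {x : EuclideanSpace ℝ (Fin 2)} (hx : ‖x‖ = 1) (h : sinCoord θ (toState x) = 0) :
    transition ψ ε x = ‖cosCoord θ (ψ (1 / ε))‖ := by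
  have h1 := norm_cosCoord_sq_add θ (toState x)
  rw [h, norm_toState, hx, norm_zero] at h1
  have h2 : ‖cosCoord θ (toState x)‖ = 1 := by
    nlinarith [norm_nonneg (cosCoord θ (toState x))]
  rw [transition, inner_toState θ, h, mul_zero, add_zero, norm_mul, h2, mul_one, RCLike.norm_conj]

section Eigenvectors

variable {f : ℝ × ℝ × ℝ → ℝ × ℝ} {p : ℝ × ℝ × ℝ} {g θ μ : ℝ} {x : EuclideanSpace ℝ (Fin 2)}

/-- In the half-angle frame `H_f` is diagonal with entries `g` and `-g`. The sign of `g` therefore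
decides which frame vector is the lower eigenvector and which the upper one. -/
theorem coords_of_mulVec_eq (h1 : (f p).1 = g * Real.cos θ) (h2 : (f p).2 = g * Real.sin θ)
    (hx : hamiltonian f p *ᵥ (x : Fin 2 → ℝ) = μ • (x : Fin 2 → ℝ)) :
    (g - μ) * (Real.cos (θ / 2) * x 0 + Real.sin (θ / 2) * x 1) = 0 ∧
      (g + μ) * (-Real.sin (θ / 2) * x 0 + Real.cos (θ / 2) * x 1) = 0 := by
  have e0 := congrFun hx 0
  have e1 := congrFun hx 1
  simp only [hamiltonian, Matrix.mulVec, dotProduct, Fin.sum_univ_two, Matrix.of_apply,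
    Matrix.cons_val', Matrix.cons_val_zero, Matrix.cons_val_one, Matrix.cons_val_fin_one,
    Pi.smul_apply, smul_eq_mul, h1, h2] at e0 e1
  have c2 : Real.cos θ = 2 * Real.cos (θ / 2) ^ 2 - 1 := by rw [← Real.cos_two_mul]; ring_nf
  have s2 : Real.sin θ = 2 * Real.sin (θ / 2) * Real.cos (θ / 2) := by
    rw [← Real.sin_two_mul]; ring_nf
  have pyth := Real.sin_sq_add_cos_sq (θ / 2)
  rw [c2, s2] at e0 e1
  set c := Real.cos (θ / 2)
  set s := Real.sin (θ / 2)
  constructor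
  · linear_combination c * e0 + s * e1 - 2 * g * c * x 0 * pyth
  · linear_combination s * e0 - c * e1 - 2 * g * c * x 1 * pyth

theorem cosCoord_toState (θ : ℝ) (x : EuclideanSpace ℝ (Fin 2)) : cosCoord θ (toState x) =
    ((Real.cos (θ / 2) * x 0 + Real.sin (θ / 2) * x 1 : ℝ) : ℂ) := by
  simp [cosCoord, toState]

theorem sinCoord_toState (θ : ℝ) (x : EuclideanSpace ℝ (Fin 2)) : sinCoord θ (toState x) =
    ((-Real.sin (θ / 2) * x 0 + Real.cos (θ / 2) * x 1 : ℝ) : ℂ) := by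
  simp [sinCoord, toState]

theorem upperEigenvalue_eq (h1 : (f p).1 = g * Real.cos θ) (h2 : (f p).2 = g * Real.sin θ) :
    upperEigenvalue f p = |g| := by
  rw [upperEigenvalue, h1, h2, ← Real.sqrt_sq_eq_abs]
  congr 1
  linear_combination g ^ 2 * Real.sin_sq_add_cos_sq θ

theorem lowerEigenvalue_eq (h1 : (f p).1 = g * Real.cos θ) (h2 : (f p).2 = g * Real.sin θ) :
    lowerEigenvalue f p = -|g| :=
  congrArg Neg.neg (upperEigenvalue_eq h1 h2)

theorem IsLowerEigenvector.cosCoord_eq_zero (hx : IsLowerEigenvector f p x)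
    (h1 : (f p).1 = g * Real.cos θ) (h2 : (f p).2 = g * Real.sin θ) (hg : 0 < g) :
    cosCoord θ (toState x) = 0 := by
  have := (coords_of_mulVec_eq h1 h2 hx.2).1
  rw [lowerEigenvalue_eq h1 h2, abs_of_pos hg] at this
  rw [cosCoord_toState, (mul_eq_zero.1 this).resolve_left (by linarith), Complex.ofReal_zero]

theorem IsLowerEigenvector.sinCoord_eq_zero (hx : IsLowerEigenvector f p x)
    (h1 : (f p).1 = g * Real.cos θ) (h2 : (f p).2 = g * Real.sin θ) (hg : g < 0) :
    sinCoord θ (toState x) = 0 := by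
  have := (coords_of_mulVec_eq h1 h2 hx.2).2
  rw [lowerEigenvalue_eq h1 h2, abs_of_neg hg] at this
  rw [sinCoord_toState, (mul_eq_zero.1 this).resolve_left (by linarith), Complex.ofReal_zero]

theorem IsUpperEigenvector.sinCoord_eq_zero (hx : IsUpperEigenvector f p x)
    (h1 : (f p).1 = g * Real.cos θ) (h2 : (f p).2 = g * Real.sin θ) (hg : 0 < g) :
    sinCoord θ (toState x) = 0 := by
  have := (coords_of_mulVec_eq h1 h2 hx.2).2
  rw [upperEigenvalue_eq h1 h2, abs_of_pos hg] at this
  rw [sinCoord_toState, (mul_eq_zero.1 this).resolve_left (by linarith), Complex.ofReal_zero]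

theorem IsUpperEigenvector.cosCoord_eq_zero (hx : IsUpperEigenvector f p x)
    (h1 : (f p).1 = g * Real.cos θ) (h2 : (f p).2 = g * Real.sin θ) (hg : g < 0) :
    cosCoord θ (toState x) = 0 := by
  have := (coords_of_mulVec_eq h1 h2 hx.2).1
  rw [upperEigenvalue_eq h1 h2, abs_of_neg hg] at this
  rw [cosCoord_toState, (mul_eq_zero.1 this).resolve_left (by linarith), Complex.ofReal_zero]

end Eigenvectors

theorem continuous_toState : Continuous toState := by
  unfold toState
  fun_prop

theorem continuous_sinCoord : Continuous fun y : ℝ × EuclideanSpace ℂ (Fin 2) =>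
    sinCoord y.1 y.2 := by
  unfold sinCoord
  fun_prop

namespace IsRotatingFrame

variable {f : ℝ × ℝ × ℝ → ℝ × ℝ} {z M ε : ℝ} {ζ' θ ρ ρ' w w' : ℝ → ℝ}

/-- After rescaling time to `[0, 1]` the diagonal entries become `±g/ε`, and differentiating the
frame of angle `θ/2` produces the coupling `w = θ'/2`. -/
theorem isAdiabaticPair (hf : IsRotatingFrame f u v z M ζ' θ ρ ρ' w w') (hε : 0 < ε)
    {ψ₀ : EuclideanSpace ℂ (Fin 2)} {ψ : ℝ → EuclideanSpace ℂ (Fin 2)}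
    (hψ : IsSchrodingerSolution f u v ε z ψ₀ ψ) :
    IsAdiabaticPair (fun t => (z - level u v t) * ρ t / ε) w
      (fun t => cosCoord (θ t) (ψ (t / ε))) (fun t => sinCoord (θ t) (ψ (t / ε))) (Icc 0 1) := by
  have key : ∀ t ∈ Icc (0 : ℝ) 1, ∃ d₀ d₁ : ℂ,
      HasDerivWithinAt (fun t => ψ (t / ε) 0) d₀ (Icc 0 1) t ∧
      HasDerivWithinAt (fun t => ψ (t / ε) 1) d₁ (Icc 0 1) t ∧
      d₀ = -Complex.I * ((z - level u v t) * ρ t / ε : ℝ) *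
        (Real.cos (θ t) * ψ (t / ε) 0 + Real.sin (θ t) * ψ (t / ε) 1) ∧
      d₁ = -Complex.I * ((z - level u v t) * ρ t / ε : ℝ) *
        (Real.sin (θ t) * ψ (t / ε) 0 - Real.cos (θ t) * ψ (t / ε) 1) := by
    intro t ht
    have hmaps : MapsTo (fun t => t / ε) (Icc (0 : ℝ) 1) (Icc 0 (1 / ε)) := fun s hs =>
      ⟨div_nonneg hs.1 hε.le, div_le_div_of_nonneg_right hs.2 hε.le⟩
    obtain ⟨d, hd, hdeq⟩ := hψ.2 (t / ε) (hmaps ht)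
    have hd' : HasDerivWithinAt (fun t => ψ (t / ε)) ((1 / ε) • d) (Icc 0 1) t :=
      hd.scomp t (((hasDerivAt_id t).div_const ε).hasDerivWithinAt) hmaps
    have hi : ∀ i, HasDerivWithinAt (fun t => ψ (t / ε) i) (((1 / ε) • d) i) (Icc 0 1) t :=
      fun i => ((EuclideanSpace.proj (𝕜 := ℂ) i).restrictScalars ℝ).hasFDerivAt.comp_hasDerivWithinAt t hd'
    rw [mul_div_cancel₀ t hε.ne'] at hdeq
    have q0 := congrArg (fun y : EuclideanSpace ℂ (Fin 2) => y 0) hdeq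
    have q1 := congrArg (fun y : EuclideanSpace ℂ (Fin 2) => y 1) hdeq
    simp only [hamiltonian, Matrix.mulVec, dotProduct, Fin.sum_univ_two, Matrix.of_apply,
      Matrix.cons_val', Matrix.cons_val_zero, Matrix.cons_val_one, Matrix.cons_val_fin_one,
      Matrix.map_apply, PiLp.smul_apply, smul_eq_mul, hf.fst_eq t ht, hf.snd_eq t ht] at q0 q1
    refine ⟨_, _, hi 0, hi 1, ?_, ?_⟩
    · rw [PiLp.smul_apply, Complex.real_smul]
      push_cast at q0 ⊢
      linear_combination (-Complex.I / ε) * q0 + d 0 / ε * Complex.I_sq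
    · rw [PiLp.smul_apply, Complex.real_smul]
      push_cast at q1 ⊢
      linear_combination (-Complex.I / ε) * q1 + d 1 / ε * Complex.I_sq
  have trig : ∀ t, (Real.cos (θ t) : ℂ) = 2 * (Real.cos (θ t / 2) : ℂ) ^ 2 - 1 ∧
      (Real.sin (θ t) : ℂ) = 2 * (Real.sin (θ t / 2) : ℂ) * (Real.cos (θ t / 2) : ℂ) ∧
      (Real.sin (θ t / 2) : ℂ) ^ 2 + (Real.cos (θ t / 2) : ℂ) ^ 2 = 1 := by
    intro t
    have c2 : Real.cos (θ t) = 2 * Real.cos (θ t / 2) ^ 2 - 1 := by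
      rw [← Real.cos_two_mul]; ring_nf
    have s2 : Real.sin (θ t) = 2 * Real.sin (θ t / 2) * Real.cos (θ t / 2) := by
      rw [← Real.sin_two_mul]; ring_nf
    exact ⟨by exact_mod_cast c2, by exact_mod_cast s2,
      by exact_mod_cast Real.sin_sq_add_cos_sq (θ t / 2)⟩
  have dcos : ∀ t ∈ Icc (0 : ℝ) 1, HasDerivWithinAt (fun t => (Real.cos (θ t / 2) : ℂ))
      (-(Real.sin (θ t / 2) : ℂ) * w t) (Icc 0 1) t := fun t ht => by
    refine ((hf.hasDeriv_θ t ht).div_const 2).cos.ofReal_comp.congr_deriv ?_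
    push_cast; ring
  have dsin : ∀ t ∈ Icc (0 : ℝ) 1, HasDerivWithinAt (fun t => (Real.sin (θ t / 2) : ℂ))
      ((Real.cos (θ t / 2) : ℂ) * w t) (Icc 0 1) t := fun t ht => by
    refine ((hf.hasDeriv_θ t ht).div_const 2).sin.ofReal_comp.congr_deriv ?_
    push_cast; ring
  constructor
  · intro t ht
    obtain ⟨d₀, d₁, h0, h1, e0, e1⟩ := key t ht
    obtain ⟨tc, ts, pyth⟩ := trig t
    refine (((dcos t ht).mul h0).add ((dsin t ht).mul h1)).congr_deriv ?_
    rw [e0, e1, tc, ts]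
    simp only [cosCoord, sinCoord]
    set c := (Real.cos (θ t / 2) : ℂ)
    set s := (Real.sin (θ t / 2) : ℂ)
    linear_combination (-Complex.I * ((z - level u v t) * ρ t / ε : ℝ)) *
      (2 * c * ψ (t / ε) 0) * pyth
  · intro t ht
    obtain ⟨d₀, d₁, h0, h1, e0, e1⟩ := key t ht
    obtain ⟨tc, ts, pyth⟩ := trig t
    have dnsin : HasDerivWithinAt (fun t => -(Real.sin (θ t / 2) : ℂ))
        (-((Real.cos (θ t / 2) : ℂ) * w t)) (Icc 0 1) t := (dsin t ht).neg
    refine ((dnsin.mul h0).add ((dcos t ht).mul h1)).congr_deriv ?_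
    rw [e0, e1, tc, ts]
    simp only [cosCoord, sinCoord]
    set c := (Real.cos (θ t / 2) : ℂ)
    set s := (Real.sin (θ t / 2) : ℂ)
    linear_combination (-Complex.I * ((z - level u v t) * ρ t / ε : ℝ)) *
      (-2 * c * ψ (t / ε) 1) * pyth

end IsRotatingFrame

end SemiConical

/-! ### Transition at a fixed level. -/

namespace SemiConical

variable {h₁ h₂ : ℝ × ℝ × ℝ → ℝ} {m : ℝ → ℝ} {U : Set (ℝ × ℝ)} {z₀ z₁ : ℝ} {u v : ℝ → ℝ}

theorem sinCoord_eq_zero_of_tendsto {l : Filter ℝ} [l.NeBot] {θ : ℝ → ℝ} {θ₀ : ℝ}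
    {φ : ℝ → EuclideanSpace ℝ (Fin 2)} {x : EuclideanSpace ℝ (Fin 2)} (hθ : Tendsto θ l (𝓝 θ₀))
    (hφ : Tendsto φ l (𝓝 x)) (h : ∀ᶠ t in l, sinCoord (θ t) (toState (φ t)) = 0) :
    sinCoord θ₀ (toState x) = 0 :=
  tendsto_nhds_unique_of_eventuallyEq
    ((continuous_sinCoord.tendsto (θ₀, toState x)).comp
      (hθ.prodMk_nhds ((continuous_toState.tendsto x).comp hφ))) tendsto_const_nhds h

theorem norm_eq_one_of_tendsto {l : Filter ℝ} [l.NeBot]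
    {φ : ℝ → EuclideanSpace ℝ (Fin 2)} {x : EuclideanSpace ℝ (Fin 2)}
    (hφ : Tendsto φ l (𝓝 x)) (h : ∀ᶠ t in l, ‖φ t‖ = 1) : ‖x‖ = 1 :=
  tendsto_nhds_unique_of_eventuallyEq hφ.norm tendsto_const_nhds h

namespace IsRotatingFrame

variable {f : ℝ × ℝ × ℝ → ℝ × ℝ} {z M ε δ η τ : ℝ} {ζ' θ ρ ρ' w w' : ℝ → ℝ}
  {x y : EuclideanSpace ℝ (Fin 2)} {ψ : ℝ → EuclideanSpace ℂ (Fin 2)}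

/-- At `z = z₀` the Hamiltonian vanishes at `t = 0` and selects no direction. For later times the
gap is negative, which fixes the eigenvector, and the frame is continuous up to `t = 0`. -/
theorem initial_sinCoord (hf : IsRotatingFrame f u v z M ζ' θ ρ ρ' w w')
    (hx : IsInitialLimitLower f u v z x) (hz : ∀ t ∈ Ioo (0 : ℝ) 1, z < level u v t) :
    ‖x‖ = 1 ∧ sinCoord (θ 0) (toState x) = 0 := by
  obtain ⟨φ, hφ, hlim⟩ := hx
  have hev : ∀ᶠ t in 𝓝[>] (0 : ℝ), t ∈ Ioo (0 : ℝ) 1 := Ioo_mem_nhdsGT one_pos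
  have hθ : Tendsto θ (𝓝[>] 0) (𝓝 (θ 0)) := by
    rw [← nhdsWithin_Ioo_eq_nhdsGT (one_pos : (0 : ℝ) < 1)]
    exact (hf.hasDeriv_θ 0 (by simp)).continuousWithinAt.mono_left
      (nhdsWithin_mono _ Ioo_subset_Icc_self)
  refine ⟨norm_eq_one_of_tendsto hlim (hev.mono fun t ht => (hφ t ht).1),
    sinCoord_eq_zero_of_tendsto hθ hlim (hev.mono fun t ht => ?_)⟩
  have ht' := Ioo_subset_Icc_self ht
  exact (hφ t ht).sinCoord_eq_zero (hf.fst_eq t ht') (hf.snd_eq t ht')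
    (mul_neg_of_neg_of_pos (sub_neg.2 (hz t ht)) (hf.pos t ht'))

theorem final_sinCoord (hf : IsRotatingFrame f u v z M ζ' θ ρ ρ' w w')
    (hx : IsFinalLimitUpper f u v z x) (hz : ∀ t ∈ Ioo (0 : ℝ) 1, level u v t < z) :
    ‖x‖ = 1 ∧ sinCoord (θ 1) (toState x) = 0 := by
  obtain ⟨φ, hφ, hlim⟩ := hx
  have hev : ∀ᶠ t in 𝓝[<] (1 : ℝ), t ∈ Ioo (0 : ℝ) 1 := Ioo_mem_nhdsLT one_pos
  have hθ : Tendsto θ (𝓝[<] 1) (𝓝 (θ 1)) := by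
    rw [← nhdsWithin_Ioo_eq_nhdsLT (one_pos : (0 : ℝ) < 1)]
    exact (hf.hasDeriv_θ 1 (by simp)).continuousWithinAt.mono_left
      (nhdsWithin_mono _ Ioo_subset_Icc_self)
  refine ⟨norm_eq_one_of_tendsto hlim (hev.mono fun t ht => (hφ t ht).1),
    sinCoord_eq_zero_of_tendsto hθ hlim (hev.mono fun t ht => ?_)⟩
  have ht' := Ioo_subset_Icc_self ht
  exact (hφ t ht).sinCoord_eq_zero (hf.fst_eq t ht') (hf.snd_eq t ht')
    (mul_pos (sub_pos.2 (hz t ht)) (hf.pos t ht'))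

theorem final_coords (hf : IsRotatingFrame f u v z M ζ' θ ρ ρ' w w') (hε : 0 < ε)
    (hψ : IsSchrodingerSolution f u v ε z (toState x) ψ) (hx : ‖x‖ = 1)
    (hη : 0 < η) (hδ : 0 ≤ δ) (hτ : τ ∈ Icc (0 : ℝ) 1)
    (hgap : ∀ t ∈ Icc (0 : ℝ) 1, δ ≤ |t - τ| → η ≤ |z - level u v t|) :
    ‖cosCoord (θ 1) (ψ (1 / ε))‖ ^ 2 + ‖sinCoord (θ 1) (ψ (1 / ε))‖ ^ 2 = 1 ∧
    (cosCoord (θ 0) (toState x) = 0 →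
      ‖cosCoord (θ 1) (ψ (1 / ε))‖ ≤ 8 * M ^ 4 * (ε / η) + 2 * M * δ) ∧
    (sinCoord (θ 0) (toState x) = 0 →
      ‖sinCoord (θ 1) (ψ (1 / ε))‖ ≤ 8 * M ^ 4 * (ε / η) + 2 * M * δ) := by
  have hpair := hf.isAdiabaticPair hε hψ
  have h0 : ψ 0 = toState x := hψ.1
  have hnorm : ∀ t ∈ Icc (0 : ℝ) 1,
      ‖cosCoord (θ t) (ψ (t / ε))‖ ^ 2 + ‖sinCoord (θ t) (ψ (t / ε))‖ ^ 2 = 1 := fun t ht => by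
    rw [hpair.norm_sq_add_norm_sq ht, norm_cosCoord_sq_add, zero_div, h0, norm_toState, hx, one_pow]
  have hp1 : ∀ t ∈ Icc (0 : ℝ) 1, ‖cosCoord (θ t) (ψ (t / ε))‖ ≤ 1 := fun t ht => by
    nlinarith [hnorm t ht, sq_nonneg ‖sinCoord (θ t) (ψ (t / ε))‖]
  have hq1 : ∀ t ∈ Icc (0 : ℝ) 1, ‖sinCoord (θ t) (ψ (t / ε))‖ ≤ 1 := fun t ht => by
    nlinarith [hnorm t ht, sq_nonneg ‖cosCoord (θ t) (ψ (t / ε))‖]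
  refine ⟨hnorm 1 (by simp), fun h => ?_, fun h => ?_⟩
  · have := hf.bounded.norm_one_le hε hpair hp1 hq1 hη hδ hτ hgap
    simpa [h0, h] using this
  · have hsw : IsAdiabaticPair (fun t => (z - level u v t) * (-ρ t) / ε) (fun t => -w t)
        (fun t => sinCoord (θ t) (ψ (t / ε))) (fun t => cosCoord (θ t) (ψ (t / ε))) (Icc 0 1) := by
      convert hpair.swap using 2
      ring
    have := hf.bounded.neg.norm_one_le hε hsw hq1 hp1 hη hδ hτ hgap
    simpa [h0, h] using this

/-- The adiabatic estimate of the transition probability at a fixed level `z`. -/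
theorem dist_transition_le (hf : IsRotatingFrame f u v z M ζ' θ ρ ρ' w w')
    (hmono : StrictMonoOn (level u v) (Icc 0 1)) (hl0 : level u v 0 = z₀) (hl1 : level u v 1 = 0)
    (z₀_neg : z₀ < 0) (hz : z ∈ Icc z₀ z₁)
    (hx : z ∈ Ioc z₀ z₁ → IsLowerEigenvector f (u 0, v 0, z) x)
    (hx' : z = z₀ → IsInitialLimitLower f u v z x)
    (hy : z ≠ 0 → IsUpperEigenvector f (u 1, v 1, z) y)
    (hy' : z = 0 → IsFinalLimitUpper f u v z y)
    (hε : 0 < ε) (hψ : IsSchrodingerSolution f u v ε z (toState x) ψ)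
    (hη : 0 < η) (hδ : 0 ≤ δ) (hτ : τ ∈ Icc (0 : ℝ) 1)
    (hgap : ∀ t ∈ Icc (0 : ℝ) 1, δ ≤ |t - τ| → η ≤ |z - level u v t|) :
    |(Ioo z₀ 0).indicator (fun _ => (1 : ℝ)) z - transition ψ ε y| ≤
      8 * M ^ 4 * (ε / η) + 2 * M * δ := by
  have i0 : (0 : ℝ) ∈ Icc (0 : ℝ) 1 := by simp
  have i1 : (1 : ℝ) ∈ Icc (0 : ℝ) 1 := by simp
  -- For `z = z₀` the gap is negative after the start, so the lower state stays on the cosine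
  -- vector. For `z > z₀` it is positive at the start and the lower state is the sine vector.
  rcases hz.1.eq_or_lt with heq | hlt
  · obtain ⟨hx1, hx0⟩ := hf.initial_sinCoord (hx' heq.symm) fun t ht => by
      rw [← heq, ← hl0]
      exact hmono i0 (Ioo_subset_Icc_self ht) ht.1
    obtain ⟨-, -, hs⟩ := hf.final_coords hε hψ hx1 hη hδ hτ hgap
    have hzneg : z < 0 := heq ▸ z₀_neg
    have hy1 := hy hzneg.ne
    have hc := hy1.cosCoord_eq_zero (hf.fst_eq 1 i1) (hf.snd_eq 1 i1)
      (mul_neg_of_neg_of_pos (by rw [hl1, sub_zero]; exact hzneg) (hf.pos 1 i1))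
    rw [indicator_of_notMem (fun h => h.1.ne heq), transition_of_cosCoord_eq_zero hy1.1 hc,
      zero_sub, abs_neg, abs_norm]
    exact hs hx0
  · have hx1 := hx ⟨hlt, hz.2⟩
    have hx0 := hx1.cosCoord_eq_zero (hf.fst_eq 0 i0) (hf.snd_eq 0 i0)
      (mul_pos (by rw [hl0]; exact sub_pos.2 hlt) (hf.pos 0 i0))
    obtain ⟨hn, hs, -⟩ := hf.final_coords hε hψ hx1.1 hη hδ hτ hgap
    rcases lt_trichotomy z 0 with hzneg | hz0 | hzpos
    · have hy1 := hy hzneg.ne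
      have hc := hy1.cosCoord_eq_zero (hf.fst_eq 1 i1) (hf.snd_eq 1 i1)
        (mul_neg_of_neg_of_pos (by rw [hl1, sub_zero]; exact hzneg) (hf.pos 1 i1))
      rw [indicator_of_mem (show z ∈ Ioo z₀ 0 from ⟨hlt, hzneg⟩), transition_of_cosCoord_eq_zero hy1.1 hc]
      refine le_trans ?_ (hs hx0)
      set a := ‖cosCoord (θ 1) (ψ (1 / ε))‖
      set b := ‖sinCoord (θ 1) (ψ (1 / ε))‖
      have ha : 0 ≤ a := norm_nonneg _
      have hb : 0 ≤ b := norm_nonneg _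
      -- Since `a² + b² = 1`, one has `1 - b ≤ 1 - b² = a² ≤ a`.
      have hb1 : b ≤ 1 := by nlinarith [sq_nonneg a]
      rw [abs_of_nonneg (sub_nonneg.2 hb1)]
      nlinarith
    · obtain ⟨hy1, hc⟩ := hf.final_sinCoord (hy' hz0) fun t ht => by
        rw [hz0, ← hl1]
        exact hmono (Ioo_subset_Icc_self ht) i1 ht.2
      rw [indicator_of_notMem (fun h => h.2.ne hz0), transition_of_sinCoord_eq_zero hy1 hc,
        zero_sub, abs_neg, abs_norm]
      exact hs hx0
    · have hy1 := hy hzpos.ne'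
      have hc := hy1.sinCoord_eq_zero (hf.fst_eq 1 i1) (hf.snd_eq 1 i1)
        (mul_pos (by rw [hl1, sub_zero]; exact hzpos) (hf.pos 1 i1))
      rw [indicator_of_notMem (fun h => h.2.not_gt hzpos), transition_of_sinCoord_eq_zero hy1.1 hc,
        zero_sub, abs_neg, abs_norm]
      exact hs hx0

end IsRotatingFrame

end SemiConical

/-! ### Uniform limit and rate. -/

open SemiConical in
theorem theorem4p9
    (h₁ h₂ : ℝ × ℝ × ℝ → ℝ) (m : ℝ → ℝ)
    (smooth_h₁ : ContDiff ℝ ∞ h₁) (smooth_h₂ : ContDiff ℝ ∞ h₂) (smooth_m : ContDiff ℝ ∞ m)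
    (h_zero : h₁ 0 = h₂ 0) (h_zero_ne : h₁ 0 ≠ 0) (m_zero : m 0 ≠ -1 ∧ m 0 ≠ 0)
    (U : Set (ℝ × ℝ)) (z₀ z₁ : ℝ)
    (compact_U : IsCompact U) (nhds_U : U ∈ 𝓝 (0 : ℝ × ℝ)) (z₀_neg : z₀ < 0) (z₁_pos : 0 < z₁)
    (h_ne : ∀ u v z : ℝ, (u, v) ∈ U → z ∈ Icc z₀ z₁ → h₁ (u, v, z) * h₂ (u, v, z) ≠ 0)
    (m_ne : ∀ u v : ℝ, (u, v) ∈ U → m u ≠ 0 ∧ m u ≠ -1)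
    (u v : ℝ → ℝ) (path : IsRegularSmoothPath u v)
    (condC : ConditionC (normalForm h₁ h₂ m) U z₀ z₁ u v)
    -- uniqueness of the crossing time `t_z` for `z ∈ [z₀, 0]`
    (crossing_unique : ∀ z ∈ Icc z₀ 0, ∀ s ∈ Icc (0 : ℝ) 1, ∀ t ∈ Icc (0 : ℝ) 1,
      (u s, v s, z) ∈ crossingSet (normalForm h₁ h₂ m) U z₀ z₁ →
      (u t, v t, z) ∈ crossingSet (normalForm h₁ h₂ m) U z₀ z₁ → s = t)
    -- the initial states `φ₋` at the beginning of the path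
    (φminus : ℝ → EuclideanSpace ℝ (Fin 2))
    (hφminus : ∀ z ∈ Ioc z₀ z₁,
      IsLowerEigenvector (normalForm h₁ h₂ m) (u 0, v 0, z) (φminus z))
    (hφminus_z₀ : IsInitialLimitLower (normalForm h₁ h₂ m) u v z₀ (φminus z₀))
    -- the target states `φ₊` at the end of the path
    (φplus : ℝ → EuclideanSpace ℝ (Fin 2))
    (hφplus : ∀ z ∈ Icc z₀ z₁, z ≠ 0 →
      IsUpperEigenvector (normalForm h₁ h₂ m) (u 1, v 1, z) (φplus z))
    (hφplus_zero : IsFinalLimitUpper (normalForm h₁ h₂ m) u v 0 (φplus 0))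
    -- the solutions of the Schroedinger equation
    (ψ : ℝ → ℝ → ℝ → EuclideanSpace ℂ (Fin 2))
    (hψ : ∀ ε > 0, ∀ z ∈ Icc z₀ z₁,
      IsSchrodingerSolution (normalForm h₁ h₂ m) u v ε z (toState (φminus z)) (ψ ε z)) :
    TendstoUniformlyOn (fun ε z => transition (ψ ε z) ε (φplus z))
        ((Ioo z₀ 0).indicator fun _ => (1 : ℝ)) (𝓝[>] 0) (Icc z₀ z₁) ∧
      ∃ C : ℝ, ∀ᶠ ε in 𝓝[>] (0 : ℝ), ∀ z ∈ Icc 0 z₁ ∪ {z₀},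
        transition (ψ ε z) ε (φplus z) ≤ C * ε ^ (1 / 3 : ℝ) := by
  have hz01 : z₀ < z₁ := z₀_neg.trans z₁_pos
  have hp : IsCrossingPath m U z₀ z₁ u v := condC.isCrossingPath h_ne
  have hmono := hp.strictMonoOn_level path z₀_neg crossing_unique
  obtain ⟨M, ζ', hframe⟩ := exists_isRotatingFrame (m := m) smooth_h₁ smooth_h₂ hz01 path hp hmono
    fun u v z hU hz => left_ne_zero_of_mul (h_ne u v z hU hz)
  have hM : 1 ≤ M := by
    obtain ⟨θ, ρ, ρ', w, w', hf⟩ := hframe z₀ (left_mem_Icc.2 hz01.le)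
    exact hf.bounded.one_le
  have hM0 : 0 < M := by linarith
  have est : ∀ ε > 0, ∀ z ∈ Icc z₀ z₁, ∀ η > 0, ∀ δ ≥ 0, ∀ τ ∈ Icc (0 : ℝ) 1,
      (∀ t ∈ Icc (0 : ℝ) 1, δ ≤ |t - τ| → η ≤ |z - level u v t|) →
      |(Ioo z₀ 0).indicator (fun _ => (1 : ℝ)) z - transition (ψ ε z) ε (φplus z)| ≤
        8 * M ^ 4 * (ε / η) + 2 * M * δ := by
    intro ε hε z hz η hη δ hδ τ hτ hgap
    obtain ⟨θ, ρ, ρ', w, w', hf⟩ := hframe z hz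
    exact hf.dist_transition_le hmono hp.level_start hp.level_final z₀_neg hz (hφminus z)
      (fun h => by rw [h]; exact hφminus_z₀) (hφplus z hz) (fun h => by rw [h]; exact hφplus_zero)
      hε (hψ ε hε z hz) hη hδ hτ hgap
  constructor
  · rw [Metric.tendstoUniformlyOn_iff]
    intro α hα
    -- The window costs `2Mδ = α/4`; the separation `η` depends on `δ` but not on `z`, and the
    -- threshold on `ε` keeps the other error below `α/2`.
    set δ := α / (8 * M)
    have hδ : 0 < δ := by positivity
    have hMδ : 2 * M * δ = α / 4 := by simp only [δ]; field_simp; norm_num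
    obtain ⟨η, hη, hsep⟩ :=
      path.contDiffOn_level.continuousOn.exists_separation hmono.injOn hδ
    filter_upwards [Ioo_mem_nhdsGT (show 0 < α * η / (16 * M ^ 4) by positivity)] with ε hε z hz
    obtain ⟨τ, hτ, hgap⟩ : ∃ τ ∈ Icc (0 : ℝ) 1,
        ∀ t ∈ Icc (0 : ℝ) 1, δ ≤ |t - τ| → η ≤ |z - level u v t| := by
      rcases le_total z 0 with h | h
      · obtain ⟨τ, hτ, hτz⟩ := intermediate_value_Icc zero_le_one
          path.contDiffOn_level.continuousOn
          (show z ∈ Icc (level u v 0) (level u v 1) from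
            ⟨hp.level_start.le.trans hz.1, h.trans hp.level_final.ge⟩)
        refine ⟨τ, hτ, fun t ht hd => ?_⟩
        rw [← hτz, abs_sub_comm]
        exact hsep t ht τ hτ hd
      · have i1 : (1 : ℝ) ∈ Icc (0 : ℝ) 1 := by simp
        -- For `z ≥ 0` the closest approach is at the end: `ζ ≤ 0` gives `|z - ζ(t)| ≥ |ζ(t) -
        -- ζ(1)|`.
        refine ⟨1, i1, fun t ht hd => (hsep t ht 1 i1 hd).trans ?_⟩
        have h1 := hmono.monotoneOn ht i1 ht.2
        rw [hp.level_final] at h1 ⊢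
        rw [sub_zero, abs_of_nonpos h1, abs_of_nonneg (by linarith)]
        linarith
    rw [Real.dist_eq]
    refine (est ε hε.1 z hz η hη δ hδ.le τ hτ hgap).trans_lt ?_
    have h2 : 8 * M ^ 4 * (ε / η) < α / 2 := by
      have h3 := (lt_div_iff₀ (by positivity)).1 hε.2
      rw [← mul_div_assoc, div_lt_iff₀ hη]
      linarith
    linarith
  · obtain ⟨c₁, hc₁, hend⟩ := hp.exists_mul_sq_le_neg_level smooth_m path m_zero condC.final_u
      condC.final_v hmono
    obtain ⟨c₀, hc₀, hstart⟩ := hp.exists_mul_sq_le_level_sub smooth_h₁ smooth_h₂ smooth_m path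
      condC.start_conical.2.1 hmono
    set c := min c₀ c₁
    have hc : 0 < c := lt_min hc₀ hc₁
    refine ⟨8 * M ^ 4 / c + 2 * M, ?_⟩
    filter_upwards [self_mem_nhdsWithin] with ε (hε : 0 < ε) z hz
    -- Outside a window of radius `r` the gap is at least `cr²`, so the errors are of orders `ε/r²`
    -- and `r`; they balance when `r³ = ε`.
    set r := ε ^ (1 / 3 : ℝ)
    have hr : 0 < r := Real.rpow_pos_of_pos hε _
    have hr3 : r ^ 3 = ε := by
      rw [← Real.rpow_natCast, ← Real.rpow_mul hε.le]
      norm_num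
    have hzI : z ∈ Icc z₀ z₁ := by
      rcases hz with h | h
      · exact ⟨z₀_neg.le.trans h.1, h.2⟩
      · rw [mem_singleton_iff.1 h]; exact left_mem_Icc.2 hz01.le
    have hind : z ∉ Ioo z₀ 0 := by
      rcases hz with h | h
      · exact fun h' => h'.2.not_ge h.1
      · exact fun h' => h'.1.ne' h
    have sq_le : ∀ t τ : ℝ, r ≤ |t - τ| → c * r ^ 2 ≤ c * (t - τ) ^ 2 := fun t τ h => by
      rw [← sq_abs (t - τ)]
      gcongr
    obtain ⟨τ, hτ, hgap⟩ : ∃ τ ∈ Icc (0 : ℝ) 1,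
        ∀ t ∈ Icc (0 : ℝ) 1, r ≤ |t - τ| → c * r ^ 2 ≤ |z - level u v t| := by
      rcases hz with h | h
      · refine ⟨1, by simp, fun t ht hd => (sq_le t 1 hd).trans ?_⟩
        have h1 : c * (t - 1) ^ 2 ≤ c₁ * (t - 1) ^ 2 :=
          mul_le_mul_of_nonneg_right (min_le_right _ _) (sq_nonneg _)
        linarith [hend t ht, h.1, le_abs_self (z - level u v t)]
      · refine ⟨0, by simp, fun t ht hd => (sq_le t 0 hd).trans ?_⟩
        have h1 : c * (t - 0) ^ 2 ≤ c₀ * (t - 0) ^ 2 :=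
          mul_le_mul_of_nonneg_right (min_le_left _ _) (sq_nonneg _)
        rw [mem_singleton_iff.1 h]
        linarith [hstart t ht, neg_abs_le (z₀ - level u v t)]
    have main := est ε hε z hzI (c * r ^ 2) (by positivity) r hr.le τ hτ hgap
    rw [indicator_of_notMem hind, zero_sub, abs_neg] at main
    have e : 8 * M ^ 4 * (ε / (c * r ^ 2)) + 2 * M * r = (8 * M ^ 4 / c + 2 * M) * r := by
      rw [← hr3]; field_simp
    rw [e] at main
    exact (le_abs_self _).trans main
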